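/- Let $N>1$ and $K_I,K_E\ge 1$ be integers. Let $h_1,\dots,h_{K_I}\in\mathbb C^N$ and $g_1,\dots,g_{K_E}\in\mathbb C^N$ be arbitrary channel vectors, let $\sigma>0$, $P_{\rm sum}>0$, $\alpha_i>0$ $(1\le i\le K_I)$ and $E_j>0$ $(1\le j\le K_E)$ be real numbers, and put $G_j=g_jg_j^H$. For positive semidefinite matrices $S_1,\dots,S_{K_I}\in\mathbb C^{N\times N}$ let $$\mathcal C(\{S_i\})=\bigcup_{\pi}\left\{r\in\mathbb R_{\ge 0}^{K_I}:\ r_{\pi(i)}\le\log_2\frac{\sigma^2+h_{\pi(i)}^H\left(\sum_{k=i}^{K_I}S_{\pi(k)}\right)h_{\pi(i)}}{\sigma^2+h_{\pi(i)}^H\left(\sum_{k=i+1}^{K_I}S_{\pi(k)}\right)h_{\pi(i)}}\ \text{ for } 1\le i\le K_I\right\},$$ where $\pi$ runs over all permutations of $\{1,\dots,K_I\}$. (P1) is the problem of maximizing $\sum_i\alpha_ir_i$ over positive semidefinite $S_1,\dots,S_{K_I},S_E\in\mathbb C^{N\times N}$ and $r\in\mathcal C(\{S_i\})$ subject to $$\operatorname{Tr}\Big[\Big(\sum_iS_i+S_E\Big)G_j\Big]\ge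 E_j\quad(1\le j\le K_E),\qquad \operatorname{Tr}\Big(\sum_iS_i+S_E\Big)\le P_{\rm sum}.$$ For real $\lambda_0,\lambda_1,\dots,\lambda_{K_E}\ge 0$ let $A=\lambda_0I-\sum_j\lambda_jG_j$ and $P_A=\lambda_0P_{\rm sum}-\sum_j\lambda_jE_j$, and let $g(\{\lambda_j\})\in[-\infty,+\infty]$ be the supremum of $\sum_i\alpha_ir_i$ over positive semidefinite $S_1,\dots,S_{K_I},S_E\in\mathbb C^{N\times N}$ and $r\in\mathcal C(\{S_i\})$ subject to the single constraint $$\sum_i\operatorname{Tr}(AS_i)+\operatorname{Tr}(AS_E)\le P_A .$$ (P2) is the problem of minimizing $g(\{\lambda_j\})$ over all $\lambda_0,\lambda_1,\dots,\lambda_{K_E}\ge 0$. Assume that (P1) is feasible. Then the optimal value of (P1) (the supremum of its objective) is equal to the optimal value of (P2) (the infimum of $g$). -/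

import Mathlib

open scoped Matrix ComplexOrder

noncomputable section

/-- Data of a MISO broadcast channel for simultaneous wireless information and power transfer:
`N` transmit antennas, `KI` information receivers and `KE` energy receivers. -/
structure SwiptBC (N KI KE : ℕ) where
  /-- channel vector to each information receiver -/
  h : Fin KI → Fin N → ℂ
  /-- channel vector to each energy receiver -/
  g : Fin KE → Fin N → ℂ
  /-- noise standard deviation; the noise power at each information receiver is `σ ^ 2` -/
  σ : ℝ
  /-- rate weights -/
  α : Fin KI → ℝ
  /-- maximum sum-power -/
  Psum : ℝ
  /-- minimum harvested power at each energy receiver -/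
  E : Fin KE → ℝ

namespace SwiptBC

variable {N KI KE : ℕ}

/-- The quadratic form `vᴴ S v`, which is a real number for Hermitian `S`. -/
def quad (S : Matrix (Fin N) (Fin N) ℂ) (v : Fin N → ℂ) : ℝ :=
  (star v ⬝ᵥ (S *ᵥ v)).re

/-- The trace `Tr(A S)` of a product, which is a real number for Hermitian `A` and `S`. -/
def trMul (A S : Matrix (Fin N) (Fin N) ℂ) : ℝ :=
  (A * S).trace.re

/-- `G j = g j (g j)ᴴ`. -/
def G (M : SwiptBC N KI KE) (j : Fin KE) : Matrix (Fin N) (Fin N) ℂ :=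
  Matrix.vecMulVec (M.g j) (star (M.g j))

/-- The dirty-paper-coding bound (bps/Hz) on the rate of the receiver `π i`, which is encoded in
the `i`-th place for the encoding order `π`: the signals encoded later are interference. -/
def dpcRate (M : SwiptBC N KI KE) (S : Fin KI → Matrix (Fin N) (Fin N) ℂ)
    (π : Equiv.Perm (Fin KI)) (i : Fin KI) : ℝ :=
  Real.logb 2
    ((M.σ ^ 2 + quad (∑ k ∈ Finset.Ici i, S (π k)) (M.h (π i))) /
      (M.σ ^ 2 + quad (∑ k ∈ Finset.Ioi i, S (π k)) (M.h (π i))))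

/-- The achievable rate region for given information covariance matrices: the union over all
encoding orders of the nonnegative rate tuples that meet the dirty-paper-coding bounds. -/
def rateRegion (M : SwiptBC N KI KE) (S : Fin KI → Matrix (Fin N) (Fin N) ℂ) :
    Set (Fin KI → ℝ) :=
  ⋃ π : Equiv.Perm (Fin KI), {r | (∀ i, 0 ≤ r i) ∧ ∀ i, r (π i) ≤ M.dpcRate S π i}

/-- The weighted sum-rate. -/
def wsr (M : SwiptBC N KI KE) (r : Fin KI → ℝ) : ℝ :=
  ∑ i, M.α i * r i

/-- The decision variables of both problems: information covariances, rates and energy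
covariance. -/
structure Point (N KI : ℕ) where
  S : Fin KI → Matrix (Fin N) (Fin N) ℂ
  r : Fin KI → ℝ
  SE : Matrix (Fin N) (Fin N) ℂ

/-- The constraints common to both problems: positive semidefinite covariances and achievable
rates. -/
def Admissible (M : SwiptBC N KI KE) (x : Point N KI) : Prop :=
  x.r ∈ M.rateRegion x.S ∧ x.SE.PosSemidef ∧ ∀ i, (x.S i).PosSemidef

/-- Feasibility for the original problem: minimum harvested powers and maximum sum-power. -/
def FeasibleP1 (M : SwiptBC N KI KE) (x : Point N KI) : Prop :=
  M.Admissible x ∧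
    (∀ j, M.E j ≤ trMul ((∑ i, x.S i) + x.SE) (M.G j)) ∧
    ((∑ i, x.S i) + x.SE).trace.re ≤ M.Psum

/-- The optimal value of the original problem, as an extended real number. -/
def optP1 (M : SwiptBC N KI KE) : EReal :=
  sSup {v : EReal | ∃ x : Point N KI, M.FeasibleP1 x ∧ v = (M.wsr x.r : EReal)}

/-- `A = l0 I - ∑ j, l j G j`. -/
def combA (M : SwiptBC N KI KE) (l0 : ℝ) (l : Fin KE → ℝ) : Matrix (Fin N) (Fin N) ℂ :=
  (l0 : ℂ) • (1 : Matrix (Fin N) (Fin N) ℂ) - ∑ j, (l j : ℂ) • M.G j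

/-- `P_A = l0 Psum - ∑ j, l j E j`. -/
def combP (M : SwiptBC N KI KE) (l0 : ℝ) (l : Fin KE → ℝ) : ℝ :=
  l0 * M.Psum - ∑ j, l j * M.E j

/-- Feasibility for the auxiliary problem with the single combined constraint. -/
def FeasibleAux (M : SwiptBC N KI KE) (l0 : ℝ) (l : Fin KE → ℝ) (x : Point N KI) : Prop :=
  M.Admissible x ∧
    (∑ i, trMul (M.combA l0 l) (x.S i)) + trMul (M.combA l0 l) x.SE ≤ M.combP l0 l

/-- The auxiliary function: the optimal value of the auxiliary problem, which is `⊤` when the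
weighted sum-rate is unbounded there. -/
def gAux (M : SwiptBC N KI KE) (l0 : ℝ) (l : Fin KE → ℝ) : EReal :=
  sSup {v : EReal | ∃ x : Point N KI, M.FeasibleAux l0 l x ∧ v = (M.wsr x.r : EReal)}

/-- The optimal value of the minimization of the auxiliary function over nonnegative
multipliers. -/
def optP2 (M : SwiptBC N KI KE) : EReal :=
  sInf {v : EReal | ∃ (l0 : ℝ) (l : Fin KE → ℝ), 0 ≤ l0 ∧ (∀ j, 0 ≤ l j) ∧ v = M.gAux l0 l}

end SwiptBC

end

/-! Weak duality is immediate: a feasible point of (P1) satisfies every nonnegative combination of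
its linear constraints. The reverse inequality is not plain convex duality, because dirty-paper
rates are not concave in the covariances; the proof goes through the dual multiple access channel
(MAC).

Broadcast to MAC. Fix multipliers with `A` positive definite and budget `P`. The rates of any
broadcast point within the combined constraint, in any encoding order, lie in the polymatroid of a
MAC with noise covariance `A` and sum power at most `P` (`exists_mac_powers`). With weights sorted
decreasingly, the weighted sum-rate is then at most `macWsr`, which is concave in the powers. So if
`c` lies below every value of g, the maximum of `macWsr` over powers is at least `c` for all such
multipliers.

Stationarity. Minimise over multipliers `x` the maximum over normalised powers `p` of the
regularised function `lagr`. The terms `-ε log det A + ε ∑ x` confine the minimisation to a compact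
set of positive definite `A` (`exists_saddle`), and `-ε ∑ p²` makes the maximising `p` unique. A
Danskin argument (`nonneg_of_unique_max_of_min`) then yields first-order conditions in `p` and in
`x`; convexity in `x` is never needed.

MAC to broadcast. Let `B i` be the received covariance of the users below `i`. The covariances `κ⁻¹
a i (B i⁻¹ - B (i+1)⁻¹)` sum to `κ⁻¹ Q`, where `-Q` is the derivative of `macWsr` in `A`. Hence
stationarity in `x` gives the power constraints up to a small error, and stationarity in `p` gives
broadcast rates at least those of the MAC (`logDet_macCov_sub_le_bcRate`). The result is
`exists_bc_approx`; compactness removes the error (`exists_bc_of_approx`). -/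

noncomputable section

namespace SwiptBC

variable {N KI KE : ℕ} {J : Type*} [Fintype J]

/-! ### The real trace pairing -/

/-- The rank-one matrix `v vᴴ`. -/
def outer (v : Fin N → ℂ) : Matrix (Fin N) (Fin N) ℂ := Matrix.vecMulVec v (star v)

/-- The logarithm of the determinant of a positive definite matrix. -/
def logDet (A : Matrix (Fin N) (Fin N) ℂ) : ℝ := Real.log A.det.re

lemma trMul_comm (A B : Matrix (Fin N) (Fin N) ℂ) : trMul A B = trMul B A := by
  simp only [trMul, Matrix.trace_mul_comm A B]

@[simp] lemma trMul_add (A B C : Matrix (Fin N) (Fin N) ℂ) :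
    trMul A (B + C) = trMul A B + trMul A C := by
  simp [trMul, Matrix.mul_add]

@[simp] lemma trMul_sub (A B C : Matrix (Fin N) (Fin N) ℂ) :
    trMul A (B - C) = trMul A B - trMul A C := by
  simp [trMul, Matrix.mul_sub]

@[simp] lemma trMul_smul (A B : Matrix (Fin N) (Fin N) ℂ) (t : ℝ) :
    trMul A (t • B) = t * trMul A B := by
  simp [trMul]

@[simp] lemma trMul_zero (A : Matrix (Fin N) (Fin N) ℂ) : trMul A 0 = 0 := by
  simp [trMul]

@[simp] lemma trMul_sum {ι : Type*} (A : Matrix (Fin N) (Fin N) ℂ) (s : Finset ι)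
    (B : ι → Matrix (Fin N) (Fin N) ℂ) : trMul A (∑ i ∈ s, B i) = ∑ i ∈ s, trMul A (B i) := by
  simp [trMul, Matrix.mul_sum, Matrix.trace_sum]

@[simp] lemma add_trMul (A B C : Matrix (Fin N) (Fin N) ℂ) :
    trMul (A + B) C = trMul A C + trMul B C := by
  simp [trMul_comm _ C]

@[simp] lemma sub_trMul (A B C : Matrix (Fin N) (Fin N) ℂ) :
    trMul (A - B) C = trMul A C - trMul B C := by
  simp [trMul_comm _ C]

@[simp] lemma smul_trMul (A B : Matrix (Fin N) (Fin N) ℂ) (t : ℝ) :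
    trMul (t • A) B = t * trMul A B := by
  simp [trMul_comm _ B]

@[simp] lemma sum_trMul {ι : Type*} (A : Matrix (Fin N) (Fin N) ℂ) (s : Finset ι)
    (B : ι → Matrix (Fin N) (Fin N) ℂ) : trMul (∑ i ∈ s, B i) A = ∑ i ∈ s, trMul (B i) A := by
  simp [trMul_comm _ A]

lemma trMul_one (A : Matrix (Fin N) (Fin N) ℂ) : trMul A 1 = A.trace.re := by
  simp [trMul]

lemma trMul_outer (A : Matrix (Fin N) (Fin N) ℂ) (v : Fin N → ℂ) :
    trMul A (outer v) = quad A v := by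
  rw [trMul, outer, Matrix.mul_vecMulVec, Matrix.trace_vecMulVec, quad, dotProduct_comm]

lemma trMul_inv_self {A : Matrix (Fin N) (Fin N) ℂ} (hA : A.PosDef) : trMul A⁻¹ A = N := by
  have hd : IsUnit A.det := (Matrix.isUnit_iff_isUnit_det A).1 hA.isUnit
  simp [trMul, Matrix.nonsing_inv_mul A hd]

lemma continuous_trMul_left (B : Matrix (Fin N) (Fin N) ℂ) :
    Continuous fun A : Matrix (Fin N) (Fin N) ℂ => trMul A B := by
  unfold trMul
  fun_prop

lemma posSemidef_outer (v : Fin N → ℂ) : (outer v).PosSemidef :=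
  Matrix.posSemidef_vecMulVec_self_star v

lemma posSemidef_smul {A : Matrix (Fin N) (Fin N) ℂ} (hA : A.PosSemidef) {t : ℝ} (ht : 0 ≤ t) :
    (t • A).PosSemidef := by
  have h : (t • A) = ((t : ℂ) • A) := by ext; simp
  rw [h]
  exact hA.smul (by exact_mod_cast ht)

open scoped MatrixOrder in
lemma exists_eq_conjTranspose_mul_self {A : Matrix (Fin N) (Fin N) ℂ} (hA : A.PosSemidef) :
    ∃ C : Matrix (Fin N) (Fin N) ℂ, A = Cᴴ * C :=
  CStarAlgebra.nonneg_iff_eq_star_mul_self.mp hA.nonneg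

lemma trMul_nonneg {A B : Matrix (Fin N) (Fin N) ℂ} (hA : A.PosSemidef) (hB : B.PosSemidef) :
    0 ≤ trMul A B := by
  obtain ⟨C, rfl⟩ := exists_eq_conjTranspose_mul_self hA
  have h := (hB.mul_mul_conjTranspose_same C).trace_nonneg
  rw [trMul, Matrix.mul_assoc, Matrix.trace_mul_comm]
  exact (Complex.le_def.1 h).1

lemma quad_nonneg {A : Matrix (Fin N) (Fin N) ℂ} (hA : A.PosSemidef) (v : Fin N → ℂ) :
    0 ≤ quad A v := by
  rw [← trMul_outer]
  exact trMul_nonneg hA (posSemidef_outer v)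

lemma quad_pos {A : Matrix (Fin N) (Fin N) ℂ} (hA : A.PosDef) {v : Fin N → ℂ} (hv : v ≠ 0) :
    0 < quad A v :=
  hA.re_dotProduct_pos hv

lemma posSemidef_of_quad {A : Matrix (Fin N) (Fin N) ℂ} (hA : A.IsHermitian)
    (h : ∀ v, 0 ≤ quad A v) : A.PosSemidef := by
  refine .of_dotProduct_mulVec_nonneg hA fun v => ?_
  rw [Complex.le_def]
  refine ⟨h v, ?_⟩
  have := hA.im_star_dotProduct_mulVec_self v
  simpa using this.symm

lemma det_re_pos {A : Matrix (Fin N) (Fin N) ℂ} (hA : A.PosDef) : 0 < A.det.re :=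
  (Complex.lt_def.1 hA.det_pos).1

/-! ### Relative spectrum of two positive definite matrices -/

/-- For `A = Cᴴ C` the numbers `w i` are the eigenvalues of `C⁻ᴴ B C⁻¹`. They reduce inequalities
between determinants and traces to scalar ones. -/
lemma exists_relative_spectrum {A B : Matrix (Fin N) (Fin N) ℂ} (hA : A.PosDef) (hB : B.PosDef) :
    ∃ w : Fin N → ℝ, (∀ i, 0 < w i) ∧ B.det.re = A.det.re * ∏ i, w i ∧
      trMul A⁻¹ B = ∑ i, w i ∧ ((A - B).PosSemidef → ∀ i, w i ≤ 1) := by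
  obtain ⟨C, hC⟩ := exists_eq_conjTranspose_mul_self hA.posSemidef
  have hdA : A.det ≠ 0 := hA.det_pos.ne'
  have hdC : IsUnit C.det := by
    refine isUnit_iff_ne_zero.2 fun h => hdA ?_
    rw [hC, Matrix.det_mul, h, mul_zero]
  have hdC' : IsUnit Cᴴ.det := by
    rw [Matrix.det_conjTranspose]; exact hdC.star
  have hCi : IsUnit C⁻¹ := (Matrix.isUnit_iff_isUnit_det _).2 (Matrix.isUnit_nonsing_inv_det C hdC)
  set X := (C⁻¹)ᴴ * B * C⁻¹ with hXdef
  have hX : X.PosDef := (Matrix.IsUnit.posDef_star_left_conjugate_iff hCi).2 hB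
  have hinv : (C⁻¹)ᴴ = (Cᴴ)⁻¹ := Matrix.conjTranspose_nonsing_inv C
  have hBX : B = Cᴴ * X * C := by
    rw [hXdef, hinv]
    simp only [Matrix.mul_assoc]
    rw [Matrix.nonsing_inv_mul C hdC, Matrix.mul_one, ← Matrix.mul_assoc,
      Matrix.mul_nonsing_inv _ hdC', Matrix.one_mul]
  have hdetX : X.det = ((∏ i, hX.1.eigenvalues i : ℝ) : ℂ) := by
    rw [hX.1.det_eq_prod_eigenvalues]; simp
  refine ⟨hX.1.eigenvalues, hX.eigenvalues_pos, ?_, ?_, ?_⟩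
  · have h : B.det = A.det * X.det := by
      rw [hC, Matrix.det_mul]
      conv_lhs => rw [hBX, Matrix.det_mul, Matrix.det_mul]
      ring
    rw [h, hdetX, Complex.re_mul_ofReal]
  · have h : (A⁻¹ * B).trace = X.trace := by
      rw [hC, Matrix.mul_inv_rev]
      conv_lhs => rw [hBX]
      rw [show C⁻¹ * (Cᴴ)⁻¹ * (Cᴴ * X * C) = C⁻¹ * (((Cᴴ)⁻¹ * Cᴴ) * (X * C)) by
        simp only [Matrix.mul_assoc], Matrix.nonsing_inv_mul _ hdC', Matrix.one_mul,
        Matrix.trace_mul_comm, Matrix.mul_assoc, Matrix.mul_nonsing_inv C hdC, Matrix.mul_one]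
    rw [trMul, h, hX.1.trace_eq_sum_eigenvalues]
    simp
  · intro hAB i
    have h1 : (1 - X).PosSemidef := by
      have h2 : 1 - X = (C⁻¹)ᴴ * (A - B) * C⁻¹ := by
        rw [Matrix.mul_sub, Matrix.sub_mul, hC, hinv, ← Matrix.mul_assoc,
          Matrix.nonsing_inv_mul _ hdC', Matrix.one_mul, Matrix.mul_nonsing_inv C hdC, hXdef, hinv]
      rw [h2]
      exact hAB.conjTranspose_mul_mul_same _
    have h3 := h1.re_dotProduct_nonneg (hX.1.eigenvectorBasis i)
    rw [Matrix.sub_mulVec, Matrix.one_mulVec, dotProduct_sub, map_sub, ← hX.1.eigenvalues_eq i]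
      at h3
    have h4 : RCLike.re (star (⇑(hX.1.eigenvectorBasis i)) ⬝ᵥ ⇑(hX.1.eigenvectorBasis i)) = 1 := by
      rw [dotProduct_comm, ← EuclideanSpace.inner_eq_star_dotProduct, inner_self_eq_norm_sq_to_K,
        hX.1.eigenvectorBasis.orthonormal.1 i]
      simp
    linarith

/-- Concavity of log det in first-order form, from `log w ≤ w - 1` on each relative eigenvalue. All
derivative estimates below rest on it. -/
lemma logDet_sub_le {A B : Matrix (Fin N) (Fin N) ℂ} (hA : A.PosDef) (hB : B.PosDef) :
    logDet B - logDet A ≤ trMul A⁻¹ (B - A) := by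
  obtain ⟨w, hw, hdet, htr, -⟩ := exists_relative_spectrum hA hB
  have hA' := det_re_pos hA
  rw [logDet, logDet, hdet, Real.log_mul hA'.ne' (Finset.prod_pos fun i _ => hw i).ne',
    Real.log_prod (fun i _ => (hw i).ne'), trMul_sub, htr, trMul_inv_self hA]
  have h : ∑ i, Real.log (w i) ≤ ∑ i, (w i - 1) :=
    Finset.sum_le_sum fun i _ => Real.log_le_sub_one_of_pos (hw i)
  simp only [Finset.sum_sub_distrib, Finset.sum_const, Finset.card_univ, Fintype.card_fin,
    nsmul_eq_mul, mul_one] at h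
  linarith

lemma one_sub_sum_one_sub_le_prod {ι : Type*} (s : Finset ι) (w : ι → ℝ) (h0 : ∀ i, 0 < w i)
    (h1 : ∀ i, w i ≤ 1) : 1 - ∑ i ∈ s, (1 - w i) ≤ ∏ i ∈ s, w i := by
  classical
  induction s using Finset.induction_on with
  | empty => simp
  | insert a s ha ih =>
    rw [Finset.sum_insert ha, Finset.prod_insert ha]
    have hp : ∏ i ∈ s, w i ≤ 1 := Finset.prod_le_one (fun i _ => (h0 i).le) fun i _ => h1 i
    nlinarith [h0 a, h1 a]

/-- The relative eigenvalues of `A` against `B` lie in (0, 1]; the left side is `1 - ∏ w i`, the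
right side `∑ (1 - w i)`. This lower bound later keeps `κ` away from zero uniformly in `ε`. -/
lemma one_sub_exp_le_trMul {A B : Matrix (Fin N) (Fin N) ℂ} (hA : A.PosDef) (hB : B.PosDef)
    (hAB : (B - A).PosSemidef) :
    1 - Real.exp (-(logDet B - logDet A)) ≤ trMul B⁻¹ (B - A) := by
  obtain ⟨w, hw, hdet, htr, hle⟩ := exists_relative_spectrum hB hA
  have hB' := det_re_pos hB
  have hp : 0 < ∏ i, w i := Finset.prod_pos fun i _ => hw i
  rw [logDet, logDet, hdet, Real.log_mul hB'.ne' hp.ne', trMul_sub, htr, trMul_inv_self hB,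
    show -(Real.log B.det.re - (Real.log B.det.re + Real.log (∏ i, w i))) =
      Real.log (∏ i, w i) by ring, Real.exp_log hp]
  have h := one_sub_sum_one_sub_le_prod Finset.univ w hw (hle hAB)
  simp only [Finset.sum_sub_distrib, Finset.sum_const, Finset.card_univ, Fintype.card_fin,
    nsmul_eq_mul, mul_one] at h
  linarith

lemma logDet_mono {A B : Matrix (Fin N) (Fin N) ℂ} (hA : A.PosDef) (hB : B.PosDef)
    (hAB : (B - A).PosSemidef) : logDet A ≤ logDet B := by
  have h := logDet_sub_le hB hA
  have h2 := trMul_nonneg hB.inv.posSemidef hAB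
  rw [trMul_sub] at h h2
  linarith

/-! ### Rank-one updates and Schur complements -/

lemma posDef_add_smul_outer {B : Matrix (Fin N) (Fin N) ℂ} (hB : B.PosDef) (v : Fin N → ℂ)
    {q : ℝ} (hq : 0 ≤ q) : (B + q • outer v).PosDef :=
  hB.add_posSemidef (posSemidef_smul (posSemidef_outer v) hq)

lemma star_dotProduct_mulVec_eq {A : Matrix (Fin N) (Fin N) ℂ} (hA : A.IsHermitian)
    (v : Fin N → ℂ) : star v ⬝ᵥ (A *ᵥ v) = (quad A v : ℂ) := by
  apply Complex.ext
  · simp [quad]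
  · simpa using hA.im_star_dotProduct_mulVec_self v

lemma logDet_add_smul_outer {B : Matrix (Fin N) (Fin N) ℂ} (hB : B.PosDef) (v : Fin N → ℂ)
    {q : ℝ} (hq : 0 ≤ q) :
    logDet (B + q • outer v) = logDet B + Real.log (1 + q * quad B⁻¹ v) := by
  have hd : IsUnit B.det := (Matrix.isUnit_iff_isUnit_det B).1 hB.isUnit
  have hx := quad_nonneg hB.inv.posSemidef v
  have h : (B + q • outer v).det = B.det * ((1 + q * quad B⁻¹ v : ℝ) : ℂ) := by
    have h1 : q • outer v = Matrix.replicateCol Unit ((q : ℂ) • v) *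
        Matrix.replicateRow Unit (star v) := by
      ext i j
      simp [outer, Matrix.vecMulVec_apply, Matrix.mul_apply, mul_assoc]
    rw [h1, Matrix.det_add_mul _ _ hd]
    congr 1
    have h2 : (Matrix.replicateRow Unit (star v) * B⁻¹ * Matrix.replicateCol Unit ((q : ℂ) • v))
        () () = (q : ℂ) * (star v ⬝ᵥ (B⁻¹ *ᵥ v)) := by
      rw [Matrix.mul_assoc, ← Matrix.replicateCol_mulVec,
        Matrix.replicateRow_mul_replicateCol_apply, Matrix.mulVec_smul, dotProduct_smul,
        smul_eq_mul]
    rw [Matrix.det_unique, Matrix.add_apply]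
    erw [h2]
    rw [star_dotProduct_mulVec_eq hB.inv.isHermitian]
    simp
  rw [logDet, h, Complex.re_mul_ofReal, Real.log_mul (det_re_pos hB).ne' (by positivity), logDet]

/-- Sherman–Morrison without division: apply `B⁻¹` to `B' (B'⁻¹ v) = v` and pair with `v`. -/
lemma quad_inv_add_smul_outer {B : Matrix (Fin N) (Fin N) ℂ} (hB : B.PosDef) (v : Fin N → ℂ)
    {q : ℝ} (hq : 0 ≤ q) :
    quad (B + q • outer v)⁻¹ v * (1 + q * quad B⁻¹ v) = quad B⁻¹ v := by
  set B' := B + q • outer v with hB'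
  have hP : B'.PosDef := posDef_add_smul_outer hB v hq
  have hd : IsUnit B.det := (Matrix.isUnit_iff_isUnit_det B).1 hB.isUnit
  have hd' : IsUnit B'.det := (Matrix.isUnit_iff_isUnit_det B').1 hP.isUnit
  have h1 : B⁻¹ *ᵥ (B' *ᵥ (B'⁻¹ *ᵥ v)) = B⁻¹ *ᵥ v := by
    rw [Matrix.mulVec_mulVec (M := B'), Matrix.mul_nonsing_inv _ hd', Matrix.one_mulVec]
  have h2 : ∀ u, B' *ᵥ u = B *ᵥ u + ((q : ℂ) * (star v ⬝ᵥ u)) • v := by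
    intro u
    rw [hB', Matrix.add_mulVec]
    congr 1
    ext i
    simp [outer, Matrix.mulVec, Matrix.vecMulVec_apply, dotProduct, Finset.mul_sum,
      Finset.sum_mul]
    refine Finset.sum_congr rfl fun j _ => by ring
  rw [h2, Matrix.mulVec_add, Matrix.mulVec_mulVec, Matrix.nonsing_inv_mul _ hd, Matrix.one_mulVec,
    Matrix.mulVec_smul, star_dotProduct_mulVec_eq hP.inv.isHermitian] at h1
  have h3 := congrArg (fun u => (star v ⬝ᵥ u).re) h1
  simp only [dotProduct_add, dotProduct_smul, star_dotProduct_mulVec_eq hP.inv.isHermitian,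
    star_dotProduct_mulVec_eq hB.inv.isHermitian, smul_eq_mul] at h3
  norm_cast at h3
  linarith

/-- Hypothesis and conclusion are the two Schur complements of the block matrix `[[B, 1], [1,
A⁻¹]]`. -/
lemma posSemidef_inv_sub_inv {A B : Matrix (Fin N) (Fin N) ℂ} (hA : A.PosDef) (hB : B.PosDef)
    (hAB : (B - A).PosSemidef) : (A⁻¹ - B⁻¹).PosSemidef := by
  have hd : IsUnit A.det := (Matrix.isUnit_iff_isUnit_det A).1 hA.isUnit
  have := hB.isUnit.invertible
  have := hA.inv.isUnit.invertible
  have h1 := (Matrix.PosDef.fromBlocks₂₂ B (1 : Matrix (Fin N) (Fin N) ℂ) hA.inv).2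
    (by simpa [Matrix.nonsing_inv_nonsing_inv A hd] using hAB)
  simpa using (Matrix.PosDef.fromBlocks₁₁ (1 : Matrix (Fin N) (Fin N) ℂ) A⁻¹ hB).1 h1

lemma quad_inv_anti {A B : Matrix (Fin N) (Fin N) ℂ} (hA : A.PosDef) (hB : B.PosDef)
    (hAB : (B - A).PosSemidef) (v : Fin N → ℂ) : quad B⁻¹ v ≤ quad A⁻¹ v := by
  have h := quad_nonneg (posSemidef_inv_sub_inv hA hB hAB) v
  rw [← trMul_outer, sub_trMul, trMul_outer, trMul_outer] at h
  linarith

/-- Pair `S` with `v vᴴ ≤ (vᴴ B⁻¹ v) B`. That inequality holds because `[[B, v], [vᴴ, x]]` with `x =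
vᴴ B⁻¹ v` has zero Schur complement over `B`, so its other Schur complement is positive
semidefinite. -/
lemma quad_le_quad_inv_mul_trMul {B S : Matrix (Fin N) (Fin N) ℂ} (hB : B.PosDef)
    (hS : S.PosSemidef) (v : Fin N → ℂ) : quad S v ≤ quad B⁻¹ v * trMul B S := by
  by_cases hv : v = 0
  · simp [hv, quad]
  have hx := quad_pos hB.inv hv
  set x := quad B⁻¹ v with hxdef
  have hD : ((x : ℂ) • (1 : Matrix Unit Unit ℂ)).PosDef :=
    Matrix.PosDef.one.smul (by exact_mod_cast hx)
  have := hB.isUnit.invertible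
  have := hD.isUnit.invertible
  have h1 := (Matrix.PosDef.fromBlocks₁₁ (Matrix.replicateCol Unit v) ((x : ℂ) • 1) hB).2 (by
    have : (x : ℂ) • (1 : Matrix Unit Unit ℂ) -
        (Matrix.replicateCol Unit v)ᴴ * B⁻¹ * Matrix.replicateCol Unit v = 0 := by
      ext i j
      rw [Matrix.mul_assoc, ← Matrix.replicateCol_mulVec, Matrix.conjTranspose_replicateCol,
        Matrix.sub_apply, Matrix.replicateRow_mul_replicateCol_apply,
        star_dotProduct_mulVec_eq hB.inv.isHermitian]
      simp [hxdef]
    rw [this]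
    exact Matrix.PosSemidef.zero)
  have h2 := (Matrix.PosDef.fromBlocks₂₂ B (Matrix.replicateCol Unit v) hD).1 h1
  have h3 : B - Matrix.replicateCol Unit v * ((x : ℂ) • (1 : Matrix Unit Unit ℂ))⁻¹ *
      (Matrix.replicateCol Unit v)ᴴ = B - x⁻¹ • outer v := by
    congr 1
    have hxC : (x : ℂ) ≠ 0 := by exact_mod_cast hx.ne'
    have : ((x : ℂ) • (1 : Matrix Unit Unit ℂ))⁻¹ = ((x : ℂ)⁻¹) • 1 := by
      apply Matrix.inv_eq_right_inv
      rw [Matrix.smul_mul, Matrix.one_mul, smul_smul, mul_inv_cancel₀ hxC, one_smul]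
    rw [this]
    ext i j
    simp [outer, Matrix.vecMulVec_apply, Matrix.mul_apply]
    ring
  rw [h3] at h2
  have h4 := trMul_nonneg h2 hS
  rw [sub_trMul, smul_trMul, trMul_comm (outer v), trMul_outer] at h4
  have h5 : x⁻¹ * quad S v ≤ trMul B S := by linarith
  rwa [inv_mul_le_iff₀ hx] at h5

/-! ### The dual multiple access channel -/

/-- The received covariance of the dual multiple access channel with noise covariance `A` when the
users in `s` transmit with powers `q`. -/
def macCov (A : Matrix (Fin N) (Fin N) ℂ) (h : ℕ → Fin N → ℂ) (q : ℕ → ℝ) (s : Finset ℕ) :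
    Matrix (Fin N) (Fin N) ℂ :=
  A + ∑ k ∈ s, q k • outer (h k)

/-- The weighted sum-rate (in nats) of the dual multiple access channel when user `0` is decoded
last, in terms of the weights `a`. -/
def macWsr (K : ℕ) (h : ℕ → Fin N → ℂ) (a : ℕ → ℝ) (A : Matrix (Fin N) (Fin N) ℂ) (q : ℕ → ℝ) :
    ℝ :=
  ∑ i ∈ Finset.range K,
    (a i - a (i + 1)) * (logDet (macCov A h q (Finset.range (i + 1))) - logDet A)

/-- The rate (in nats) of user `i` in the broadcast channel with unit noise when the users
`0, …, K - 1` are encoded in increasing order. -/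
def bcRate (K : ℕ) (h : ℕ → Fin N → ℂ) (S : ℕ → Matrix (Fin N) (Fin N) ℂ) (i : ℕ) : ℝ :=
  Real.log ((1 + quad (∑ k ∈ Finset.Ico i K, S k) (h i)) /
    (1 + quad (∑ k ∈ Finset.Ico (i + 1) K, S k) (h i)))

lemma sum_range_mul_eq_by_parts (a r : ℕ → ℝ) (K : ℕ) :
    ∑ i ∈ Finset.range K, a i * r i =
      ∑ i ∈ Finset.range K, (a i - a (i + 1)) * ∑ k ∈ Finset.range (i + 1), r k +
        a K * ∑ k ∈ Finset.range K, r k := by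
  induction K with
  | zero => simp
  | succ K ih =>
    rw [Finset.sum_range_succ, ih, Finset.sum_range_succ (fun i => (a i - a (i + 1)) * _),
      Finset.sum_range_succ r K]
    ring

lemma posSemidef_sum_smul_outer (h : ℕ → Fin N → ℂ) {q : ℕ → ℝ} {s : Finset ℕ}
    (hq : ∀ k ∈ s, 0 ≤ q k) : (∑ k ∈ s, q k • outer (h k)).PosSemidef :=
  Matrix.posSemidef_sum s fun k hk => posSemidef_smul (posSemidef_outer (h k)) (hq k hk)

lemma posDef_macCov {A : Matrix (Fin N) (Fin N) ℂ} (hA : A.PosDef) (h : ℕ → Fin N → ℂ)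
    {q : ℕ → ℝ} {s : Finset ℕ} (hq : ∀ k ∈ s, 0 ≤ q k) : (macCov A h q s).PosDef :=
  hA.add_posSemidef (posSemidef_sum_smul_outer h hq)

lemma posSemidef_macCov_sub (A : Matrix (Fin N) (Fin N) ℂ) (h : ℕ → Fin N → ℂ)
    {q : ℕ → ℝ} {s t : Finset ℕ} (hst : s ⊆ t) (hq : ∀ k ∈ t, 0 ≤ q k) :
    (macCov A h q t - macCov A h q s).PosSemidef := by
  have h1 : macCov A h q t - macCov A h q s = ∑ k ∈ t \ s, q k • outer (h k) := by
    rw [macCov, macCov, ← Finset.sum_sdiff hst]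
    abel
  rw [h1]
  exact posSemidef_sum_smul_outer h fun k hk => hq k (Finset.mem_sdiff.1 hk).1

lemma macCov_insert (A : Matrix (Fin N) (Fin N) ℂ) (h : ℕ → Fin N → ℂ) (q : ℕ → ℝ)
    {s : Finset ℕ} {k : ℕ} (hk : k ∉ s) :
    macCov A h q (insert k s) = macCov A h q s + q k • outer (h k) := by
  rw [macCov, Finset.sum_insert hk, macCov]
  abel

lemma macCov_empty (A : Matrix (Fin N) (Fin N) ℂ) (h : ℕ → Fin N → ℂ) (q : ℕ → ℝ) :
    macCov A h q ∅ = A := by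
  simp [macCov]

/-- The rates of successive decoding lie in the polymatroid of the multiple access channel. -/
lemma sum_log_le_logDet_macCov {A : Matrix (Fin N) (Fin N) ℂ} (hA : A.PosDef)
    (h : ℕ → Fin N → ℂ) {q : ℕ → ℝ} (hq : ∀ k, 0 ≤ q k) (U : Finset ℕ) :
    ∑ i ∈ U, Real.log (1 + q i * quad (macCov A h q (Finset.range i))⁻¹ (h i)) ≤
      logDet (macCov A h q U) - logDet A := by
  induction U using Finset.induction_on_max with
  | empty => simp [macCov_empty]
  | insert m U hm ih =>
    have hmU : m ∉ U := fun hmem => lt_irrefl m (hm m hmem)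
    have hU : (macCov A h q U).PosDef := posDef_macCov hA h fun k _ => hq k
    have hR : (macCov A h q (Finset.range m)).PosDef := posDef_macCov hA h fun k _ => hq k
    have hsub : U ⊆ Finset.range m := fun k hk => Finset.mem_range.2 (hm k hk)
    rw [Finset.sum_insert hmU, macCov_insert A h q hmU, logDet_add_smul_outer hU _ (hq m)]
    -- All of `U` lies below its new maximum `m`, so `m` meets no more interference from `U` than
    -- from all users below `m`.
    have h1 := quad_inv_anti hU hR (posSemidef_macCov_sub A h hsub fun k _ => hq k) (h m)
    have h0 := quad_nonneg hR.inv.posSemidef (h m)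
    have h2 : Real.log (1 + q m * quad (macCov A h q (Finset.range m))⁻¹ (h m)) ≤
        Real.log (1 + q m * quad (macCov A h q U)⁻¹ (h m)) :=
      Real.log_le_log (by have := mul_nonneg (hq m) h0; linarith)
        (by have := mul_le_mul_of_nonneg_left h1 (hq m); linarith)
    linarith

/-- The covariances of the multiple access channel in which user `i` has SINR `γ i`, obtained by
choosing the powers successively. -/
def sinrCov (A : Matrix (Fin N) (Fin N) ℂ) (h : ℕ → Fin N → ℂ) (γ : ℕ → ℝ) :
    ℕ → Matrix (Fin N) (Fin N) ℂ
  | 0 => A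
  | i + 1 => sinrCov A h γ i + (γ i / quad (sinrCov A h γ i)⁻¹ (h i)) • outer (h i)

lemma quad_sum {ι : Type*} (s : Finset ι) (S : ι → Matrix (Fin N) (Fin N) ℂ) (v : Fin N → ℂ) :
    quad (∑ k ∈ s, S k) v = ∑ k ∈ s, quad (S k) v := by
  simp_rw [← trMul_outer]
  exact sum_trMul _ _ _

/-- The powers give user `i` the same SINR in the MAC, where the lower users interfere, as in the
broadcast channel, where the higher users do. On summing the per-user power bounds, the cross terms
`q k * quad (S i) (h k)` with `k < i` occur on both sides and cancel. -/
lemma exists_mac_powers {A : Matrix (Fin N) (Fin N) ℂ} (hA : A.PosDef) (K : ℕ)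
    (h : ℕ → Fin N → ℂ) {S : ℕ → Matrix (Fin N) (Fin N) ℂ} (hS : ∀ k, (S k).PosSemidef) :
    ∃ q : ℕ → ℝ, (∀ k, 0 ≤ q k) ∧
      ∑ k ∈ Finset.range K, q k ≤ ∑ k ∈ Finset.range K, trMul A (S k) ∧
      ∀ U ⊆ Finset.range K,
        ∑ i ∈ U, bcRate K h S i ≤ logDet (macCov A h q U) - logDet A := by
  set T : ℕ → Matrix (Fin N) (Fin N) ℂ := fun i => ∑ k ∈ Finset.Ico i K, S k with hT
  have hTpos : ∀ i, (T i).PosSemidef := fun i => Matrix.posSemidef_sum _ fun k _ => hS k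
  set γ : ℕ → ℝ := fun i => quad (S i) (h i) / (1 + quad (T (i + 1)) (h i)) with hγ
  set q : ℕ → ℝ := fun i => γ i / quad (sinrCov A h γ i)⁻¹ (h i) with hq
  have hT0 : ∀ i j, 0 ≤ quad (T i) (h j) := fun i j => quad_nonneg (hTpos i) _
  have hγ0 : ∀ i, 0 ≤ γ i := fun i =>
    div_nonneg (quad_nonneg (hS i) _) (by have := hT0 (i + 1) i; linarith)
  have hB : ∀ i, (sinrCov A h γ i).PosDef := by
    intro i
    induction i with
    | zero => exact hA
    | succ i ih =>
      exact posDef_add_smul_outer ih _ (div_nonneg (hγ0 i) (quad_nonneg ih.inv.posSemidef _))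
  have hx0 : ∀ i, 0 ≤ quad (sinrCov A h γ i)⁻¹ (h i) :=
    fun i => quad_nonneg (hB i).inv.posSemidef _
  have hq0 : ∀ i, 0 ≤ q i := fun i => div_nonneg (hγ0 i) (hx0 i)
  have hcov : ∀ i, macCov A h q (Finset.range i) = sinrCov A h γ i := by
    intro i
    induction i with
    | zero => simp [macCov, sinrCov]
    | succ i ih =>
      rw [Finset.range_add_one, macCov_insert A h q Finset.notMem_range_self, ih]
      rfl
  refine ⟨q, hq0, ?_, ?_⟩
  · have h1 : ∀ i, q i * (1 + quad (T (i + 1)) (h i)) ≤ trMul (sinrCov A h γ i) (S i) := by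
      intro i
      have hd : 0 < 1 + quad (T (i + 1)) (h i) := by have := hT0 (i + 1) i; linarith
      have htr := trMul_nonneg (hB i).posSemidef (hS i)
      -- The quadratic form vanishes only for `h i = 0`; division by zero then sets `q i = 0`.
      rcases (hx0 i).eq_or_lt with hx | hx
      · simp only [hq, ← hx, div_zero, zero_mul]
        exact htr
      · have h2 := quad_le_quad_inv_mul_trMul (hB i) (hS i) (h i)
        have h3 : q i * (1 + quad (T (i + 1)) (h i)) =
            quad (S i) (h i) / quad (sinrCov A h γ i)⁻¹ (h i) := by
          simp only [hq, hγ]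
          field_simp
        rw [h3, div_le_iff₀ hx]
        linarith
    have h2 : ∀ i, trMul (sinrCov A h γ i) (S i) =
        trMul A (S i) + ∑ k ∈ Finset.range i, q k * quad (S i) (h k) := by
      intro i
      rw [← hcov, macCov, add_trMul, sum_trMul]
      congr 1
      refine Finset.sum_congr rfl fun k _ => ?_
      rw [smul_trMul, trMul_comm, trMul_outer]
    have h3 : ∑ i ∈ Finset.range K, ∑ k ∈ Finset.range i, q k * quad (S i) (h k) =
        ∑ i ∈ Finset.range K, q i * quad (T (i + 1)) (h i) := by
      simp only [hT, quad_sum, Finset.mul_sum]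
      refine Finset.sum_comm' fun i k => ?_
      simp only [Finset.mem_range, Finset.mem_Ico]
      omega
    have h4 := Finset.sum_le_sum fun i (_ : i ∈ Finset.range K) => h1 i
    simp only [h2, mul_add, mul_one, Finset.sum_add_distrib, h3] at h4
    linarith
  · intro U hU
    refine le_of_eq_of_le (Finset.sum_congr rfl fun i hi => ?_) (sum_log_le_logDet_macCov hA h hq0 U)
    have hd : 0 < 1 + quad (T (i + 1)) (h i) := by have := hT0 (i + 1) i; linarith
    have hqx : q i * quad (sinrCov A h γ i)⁻¹ (h i) = γ i := by
      by_cases hv : h i = 0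
      · simp [hγ, hv, quad]
      · exact div_mul_cancel₀ _ (quad_pos (hB i).inv hv).ne'
    have hsplit : quad (T i) (h i) = quad (S i) (h i) + quad (T (i + 1)) (h i) := by
      have hiK : i < K := Finset.mem_range.1 (hU hi)
      simp only [hT, quad_sum]
      rw [Finset.sum_eq_sum_Ico_succ_bot hiK]
    rw [hcov, hqx, bcRate]
    congr 1
    change (1 + quad (T i) (h i)) / (1 + quad (T (i + 1)) (h i)) = _
    rw [hsplit, hγ]
    field_simp
    ring

/-! ### Minimax tools -/

/-- A one-sided Danskin theorem. Points `y` with `Φ 0 p ≤ Φ t y` accumulate, as `t → 0`, only at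
maximisers of `Φ 0`, hence at `p`. Moreover `0 ≤ Φ t y - Φ 0 y ≤ t ψ t y`; divide by `t` and pass to
the limit. -/
lemma nonneg_of_unique_max_of_min {Y : Type*} [TopologicalSpace Y] [FirstCountableTopology Y]
    {D : Set Y} (hD : IsCompact D) {τ : ℝ} (hτ : 0 < τ) {Φ ψ : ℝ → Y → ℝ}
    (hΦ : ContinuousOn (Function.uncurry Φ) (Set.Ico 0 τ ×ˢ D))
    (hψ : ContinuousOn (Function.uncurry ψ) (Set.Ico 0 τ ×ˢ D)) {p : Y}
    (hmax : ∀ y ∈ D, Φ 0 y ≤ Φ 0 p) (huniq : ∀ y ∈ D, Φ 0 p ≤ Φ 0 y → y = p)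
    (hmin : ∀ t ∈ Set.Ioo 0 τ, ∃ y ∈ D, Φ 0 p ≤ Φ t y)
    (hder : ∀ t ∈ Set.Ioo 0 τ, ∀ y ∈ D, Φ t y - Φ 0 y ≤ t * ψ t y) : 0 ≤ ψ 0 p := by
  set t : ℕ → ℝ := fun n => τ / (n + 2) with ht
  have htmem : ∀ n, t n ∈ Set.Ioo 0 τ := by
    intro n
    have hn : (0 : ℝ) ≤ n := n.cast_nonneg
    exact ⟨by simp only [ht]; positivity, div_lt_self hτ (by linarith)⟩
  have htlim : Filter.Tendsto t Filter.atTop (nhds 0) := by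
    have h1 : Filter.Tendsto (fun n : ℕ => (n : ℝ) + 2) Filter.atTop Filter.atTop :=
      Filter.tendsto_atTop_add_const_right _ _ tendsto_natCast_atTop_atTop
    exact h1.const_div_atTop τ
  choose y hyD hy using fun n => hmin (t n) (htmem n)
  obtain ⟨z, hz, φ, hφ, hlim⟩ := hD.tendsto_subseq hyD
  have hmem0 : ∀ w ∈ D, ((0 : ℝ), w) ∈ Set.Ico 0 τ ×ˢ D := fun w hw => ⟨⟨le_rfl, hτ⟩, hw⟩
  have hpair : Filter.Tendsto (fun n => (t (φ n), y (φ n))) Filter.atTop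
      (nhdsWithin ((0 : ℝ), z) (Set.Ico 0 τ ×ˢ D)) := by
    refine tendsto_nhdsWithin_iff.2 ⟨?_, Filter.Eventually.of_forall fun n => ?_⟩
    · exact (htlim.comp hφ.tendsto_atTop).prodMk_nhds hlim
    · exact ⟨⟨(htmem _).1.le, (htmem _).2⟩, hyD _⟩
  have h1 : Filter.Tendsto (fun n => Φ (t (φ n)) (y (φ n))) Filter.atTop (nhds (Φ 0 z)) :=
    (hΦ _ (hmem0 z hz)).tendsto.comp hpair
  have hzp : z = p := huniq z hz (ge_of_tendsto' h1 fun n => hy _)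
  have h2 : Filter.Tendsto (fun n => ψ (t (φ n)) (y (φ n))) Filter.atTop (nhds (ψ 0 z)) :=
    (hψ _ (hmem0 z hz)).tendsto.comp hpair
  rw [hzp] at h2
  refine ge_of_tendsto' h2 fun n => ?_
  have h3 := hder _ (htmem (φ n)) _ (hyD (φ n))
  have h4 := hmax _ (hyD (φ n))
  have h5 := hy (φ n)
  exact nonneg_of_mul_nonneg_right (by linarith) (htmem (φ n)).1

/-- Only the upper value is attained: `x` minimises the continuous function `max_y Φ x y`. Without
convexity, `y'` has to depend on `x'`. -/
lemma exists_minimax {X Y : Type*} [TopologicalSpace X] [TopologicalSpace Y] {C : Set X}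
    {D : Set Y} (hC : IsCompact C) (hC' : C.Nonempty) (hD : IsCompact D) (hD' : D.Nonempty)
    {Φ : X → Y → ℝ} (hΦ : ContinuousOn (Function.uncurry Φ) (C ×ˢ D)) :
    ∃ x ∈ C, ∃ y ∈ D, (∀ y' ∈ D, Φ x y' ≤ Φ x y) ∧ ∀ x' ∈ C, ∃ y' ∈ D, Φ x y ≤ Φ x' y' := by
  have : CompactSpace C := isCompact_iff_compactSpace.1 hC
  have : CompactSpace D := isCompact_iff_compactSpace.1 hD
  have : Nonempty C := hC'.to_subtype
  have : Nonempty D := hD'.to_subtype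
  set Ψ : C → D → ℝ := fun x y => Φ x y with hΨdef
  have hΨ : Continuous (Function.uncurry Ψ) :=
    hΦ.comp_continuous (f := fun z : C × D => ((z.1 : X), (z.2 : Y))) (by fun_prop)
      fun z => ⟨z.1.2, z.2.2⟩
  have hmax : ∀ x : C, ∃ y : D, ∀ y' : D, Ψ x y' ≤ Ψ x y := by
    intro x
    have hc : Continuous (Ψ x) := hΨ.comp (by fun_prop : Continuous fun y : D => (x, y))
    obtain ⟨y, -, hy⟩ := isCompact_univ.exists_isMaxOn Set.univ_nonempty hc.continuousOn
    exact ⟨y, fun y' => hy (Set.mem_univ y')⟩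
  choose Y hY using hmax
  have hF : ∀ x, sSup (Ψ x '' Set.univ) = Ψ x (Y x) := by
    intro x
    refine le_antisymm (csSup_le (Set.univ_nonempty.image _) ?_) (le_csSup ?_ ⟨Y x, trivial, rfl⟩)
    · rintro _ ⟨y, -, rfl⟩; exact hY x y
    · exact ⟨Ψ x (Y x), by rintro _ ⟨y, -, rfl⟩; exact hY x y⟩
  have hcont : Continuous fun x => sSup (Ψ x '' Set.univ) :=
    isCompact_univ.continuous_sSup hΨ
  obtain ⟨x, -, hx⟩ := isCompact_univ.exists_isMinOn (Set.univ_nonempty (α := C))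
    hcont.continuousOn
  refine ⟨x, x.2, Y x, (Y x).2, fun y' hy' => hY x ⟨y', hy'⟩, fun x' hx' => ?_⟩
  refine ⟨Y ⟨x', hx'⟩, (Y ⟨x', hx'⟩).2, ?_⟩
  have h := hx (Set.mem_univ (⟨x', hx'⟩ : C))
  simp only [Set.mem_ofPred_eq, hF] at h
  exact h

/-! ### Continuity and closedness for positive definite matrices -/

lemma continuousOn_logDet :
    ContinuousOn (logDet : Matrix (Fin N) (Fin N) ℂ → ℝ) {A | A.PosDef} := by
  have h : Continuous fun A : Matrix (Fin N) (Fin N) ℂ => A.det.re := by fun_prop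
  exact h.continuousOn.log fun A hA => (det_re_pos hA).ne'

lemma continuousOn_inv_posDef :
    ContinuousOn (fun A : Matrix (Fin N) (Fin N) ℂ => A⁻¹) {A | A.PosDef} := by
  have h : (fun A : Matrix (Fin N) (Fin N) ℂ => A⁻¹) = fun A => (A.det)⁻¹ • A.adjugate := by
    funext A
    rw [Matrix.inv_def, Ring.inverse_eq_inv']
  rw [h]
  have h1 : ContinuousOn (fun A : Matrix (Fin N) (Fin N) ℂ => (A.det)⁻¹) {A | A.PosDef} :=
    (continuous_id.matrix_det).continuousOn.inv₀ fun A hA => Matrix.PosDef.det_pos hA |>.ne'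
  exact h1.smul (continuous_id.matrix_adjugate).continuousOn

lemma continuous_quad (v : Fin N → ℂ) :
    Continuous fun A : Matrix (Fin N) (Fin N) ℂ => quad A v := by
  unfold quad
  fun_prop

lemma isClosed_posSemidef : IsClosed {A : Matrix (Fin N) (Fin N) ℂ | A.PosSemidef} := by
  have h : {A : Matrix (Fin N) (Fin N) ℂ | A.PosSemidef} =
      {A | Aᴴ = A} ∩ ⋂ v, {A | 0 ≤ quad A v} := by
    ext A
    simp only [Set.mem_inter_iff, Set.mem_iInter]
    exact ⟨fun hA => ⟨hA.isHermitian, quad_nonneg hA⟩, fun hA => posSemidef_of_quad hA.1 hA.2⟩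
  rw [h]
  refine (isClosed_eq (by fun_prop) continuous_id).inter (isClosed_iInter fun v => ?_)
  exact isClosed_le continuous_const (continuous_quad v)

/-! ### The power simplex -/

/-- The normalised power allocations of the users `0, …, K - 1`. -/
def powerSimplex (K : ℕ) : Set (ℕ → ℝ) :=
  {p | (∀ k, 0 ≤ p k) ∧ (∀ k, K ≤ k → p k = 0) ∧ ∑ k ∈ Finset.range K, p k = 1}

lemma le_one_of_mem_powerSimplex {K : ℕ} {p : ℕ → ℝ} (hp : p ∈ powerSimplex K) (k : ℕ) :
    p k ≤ 1 := by
  by_cases hk : k < K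
  · rw [← hp.2.2]
    exact Finset.single_le_sum (fun i _ => hp.1 i) (Finset.mem_range.2 hk)
  · rw [hp.2.1 k (not_lt.1 hk)]; exact zero_le_one

lemma single_mem_powerSimplex {K l : ℕ} (hl : l < K) : Pi.single l 1 ∈ powerSimplex K := by
  refine ⟨fun k => ?_, fun k hk => ?_, ?_⟩
  · by_cases h : k = l
    · subst h; simp
    · simp [h]
  · exact Pi.single_eq_of_ne (by omega) _
  · simp [hl]

lemma isCompact_powerSimplex (K : ℕ) : IsCompact (powerSimplex K) := by
  refine (isCompact_univ_pi fun _ : ℕ => isCompact_Icc (a := (0 : ℝ)) (b := 1)).of_isClosed_subset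
    ?_ fun p hp k _ => ⟨hp.1 k, le_one_of_mem_powerSimplex hp k⟩
  have h : powerSimplex K = (⋂ k, {p : ℕ → ℝ | 0 ≤ p k}) ∩
      ((⋂ k, ⋂ (_ : K ≤ k), {p : ℕ → ℝ | p k = 0}) ∩
        {p | ∑ k ∈ Finset.range K, p k = 1}) := by
    ext p
    simp [powerSimplex]
  rw [h]
  refine (isClosed_iInter fun k => isClosed_le continuous_const (continuous_apply k)).inter
    ((isClosed_iInter fun k => isClosed_iInter fun _ =>
      isClosed_eq (continuous_apply k) continuous_const).inter
      (isClosed_eq (by fun_prop) continuous_const))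

lemma sum_sq_le_one_of_mem_powerSimplex {K : ℕ} {p : ℕ → ℝ} (hp : p ∈ powerSimplex K) :
    ∑ k ∈ Finset.range K, p k ^ 2 ≤ 1 := by
  rw [← hp.2.2]
  refine Finset.sum_le_sum fun k _ => ?_
  have h0 := hp.1 k
  have h1 := le_one_of_mem_powerSimplex hp k
  nlinarith

lemma add_smul_sub_mem_powerSimplex {K : ℕ} {p p' : ℕ → ℝ} (hp : p ∈ powerSimplex K)
    (hp' : p' ∈ powerSimplex K) {t : ℝ} (h0 : 0 ≤ t) (h1 : t ≤ 1) :
    p + t • (p' - p) ∈ powerSimplex K := by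
  refine ⟨fun k => ?_, fun k hk => ?_, ?_⟩
  · have := hp.1 k
    have := hp'.1 k
    simp only [Pi.add_apply, Pi.smul_apply, Pi.sub_apply, smul_eq_mul]
    nlinarith
  · simp [hp.2.1 k hk, hp'.2.1 k hk]
  · simp [Finset.sum_add_distrib, ← Finset.mul_sum, hp.2.2, hp'.2.2]

/-! ### First-order estimates for the multiple access channel -/

/-- The derivative of `macWsr` with respect to the power of user `k`. -/
def macGrad (K : ℕ) (h : ℕ → Fin N → ℂ) (a : ℕ → ℝ) (A : Matrix (Fin N) (Fin N) ℂ) (q : ℕ → ℝ)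
    (k : ℕ) : ℝ :=
  ∑ i ∈ Finset.Ico k K,
    (a i - a (i + 1)) * quad (macCov A h q (Finset.range (i + 1)))⁻¹ (h k)

/-- The weighted sum of the inverse received covariances. -/
def macInv (K : ℕ) (h : ℕ → Fin N → ℂ) (a : ℕ → ℝ) (A : Matrix (Fin N) (Fin N) ℂ) (q : ℕ → ℝ) :
    Matrix (Fin N) (Fin N) ℂ :=
  ∑ i ∈ Finset.range K, (a i - a (i + 1)) • (macCov A h q (Finset.range (i + 1)))⁻¹

lemma sum_trMul_inv_eq_sum_macGrad (K : ℕ) (h : ℕ → Fin N → ℂ) (a : ℕ → ℝ)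
    (A : Matrix (Fin N) (Fin N) ℂ) (q r : ℕ → ℝ) :
    ∑ i ∈ Finset.range K, (a i - a (i + 1)) *
        trMul (macCov A h q (Finset.range (i + 1)))⁻¹
          (∑ k ∈ Finset.range (i + 1), r k • outer (h k)) =
      ∑ k ∈ Finset.range K, r k * macGrad K h a A q k := by
  simp only [macGrad, trMul_sum, trMul_smul, trMul_outer, Finset.mul_sum]
  rw [Finset.sum_comm' (t' := Finset.range K) (s' := fun k => Finset.Ico k K)]
  · exact Finset.sum_congr rfl fun k _ => Finset.sum_congr rfl fun i _ => by ring
  · intro i k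
    simp only [Finset.mem_range, Finset.mem_Ico]
    omega

lemma sum_weight_sub {a : ℕ → ℝ} {K : ℕ} (haK : a K = 0) :
    ∑ i ∈ Finset.range K, (a i - a (i + 1)) = a 0 := by
  rw [Finset.sum_range_sub' a K, haK, sub_zero]

/-- Since the weight differences telescope to `a 0`, `macWsr` is a nonnegative combination of log
dets of received covariances minus `a 0 log det A`. The first part is concave and is linearised at
`(A, q)`; the second is convex and is kept exact. -/
lemma macWsr_sub_le {K : ℕ} (h : ℕ → Fin N → ℂ) {a : ℕ → ℝ} (ha : Antitone a) (haK : a K = 0)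
    {A A' : Matrix (Fin N) (Fin N) ℂ} (hA : A.PosDef) (hA' : A'.PosDef) {q q' : ℕ → ℝ}
    (hq : ∀ k, 0 ≤ q k) (hq' : ∀ k, 0 ≤ q' k) :
    macWsr K h a A' q' - macWsr K h a A q ≤
      ∑ k ∈ Finset.range K, (q' k - q k) * macGrad K h a A q k +
        trMul (macInv K h a A q) (A' - A) - a 0 * (logDet A' - logDet A) := by
  rw [← sum_trMul_inv_eq_sum_macGrad K h a A q fun k => q' k - q k]
  have h1 : ∀ i ∈ Finset.range K,
      (a i - a (i + 1)) * (logDet (macCov A' h q' (Finset.range (i + 1))) -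
        logDet (macCov A h q (Finset.range (i + 1)))) ≤
      (a i - a (i + 1)) * trMul (macCov A h q (Finset.range (i + 1)))⁻¹
          (∑ k ∈ Finset.range (i + 1), (q' k - q k) • outer (h k)) +
      (a i - a (i + 1)) * trMul (macCov A h q (Finset.range (i + 1)))⁻¹ (A' - A) := by
    intro i _
    rw [← mul_add, ← trMul_add]
    refine mul_le_mul_of_nonneg_left ?_ (sub_nonneg.2 (ha (Nat.le_succ i)))
    refine (logDet_sub_le (posDef_macCov hA h fun k _ => hq k)
      (posDef_macCov hA' h fun k _ => hq' k)).trans (le_of_eq ?_)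
    congr 1
    simp only [macCov, sub_smul, Finset.sum_sub_distrib]
    abel
  have h2 := Finset.sum_le_sum h1
  rw [Finset.sum_add_distrib] at h2
  have h3 : trMul (macInv K h a A q) (A' - A) = ∑ i ∈ Finset.range K,
      (a i - a (i + 1)) * trMul (macCov A h q (Finset.range (i + 1)))⁻¹ (A' - A) := by
    rw [macInv, sum_trMul]
    simp only [smul_trMul]
  have h4 : macWsr K h a A' q' - macWsr K h a A q = ∑ i ∈ Finset.range K,
      (a i - a (i + 1)) * (logDet (macCov A' h q' (Finset.range (i + 1))) -
        logDet (macCov A h q (Finset.range (i + 1)))) - a 0 * (logDet A' - logDet A) := by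
    rw [← sum_weight_sub haK, macWsr, macWsr, ← Finset.sum_sub_distrib, Finset.sum_mul,
      ← Finset.sum_sub_distrib]
    exact Finset.sum_congr rfl fun i _ => by ring
  rw [h3, h4]
  linarith

lemma macWsr_nonneg (K : ℕ) (h : ℕ → Fin N → ℂ) {a : ℕ → ℝ} (ha : Antitone a)
    {A : Matrix (Fin N) (Fin N) ℂ} (hA : A.PosDef) {q : ℕ → ℝ} (hq : ∀ k, 0 ≤ q k) :
    0 ≤ macWsr K h a A q := by
  refine Finset.sum_nonneg fun i _ => mul_nonneg (sub_nonneg.2 (ha (Nat.le_succ i))) ?_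
  have h1 := logDet_mono hA (posDef_macCov hA h (s := Finset.range (i + 1)) fun k _ => hq k)
    (by simpa [macCov] using posSemidef_sum_smul_outer h fun k _ => hq k)
  linarith

/-! ### Linear power constraints -/

/-- The noise covariance of the dual channel for the multipliers `x`. -/
def linCov (W : J → Matrix (Fin N) (Fin N) ℂ) (x : J → ℝ) : Matrix (Fin N) (Fin N) ℂ :=
  ∑ j, x j • W j

/-- The power budget of the dual channel for the multipliers `x`. -/
def linBudget (e x : J → ℝ) : ℝ := ∑ j, x j * e j

lemma linCov_add_smul (W : J → Matrix (Fin N) (Fin N) ℂ) (x d : J → ℝ) (t : ℝ) :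
    linCov W (x + t • d) = linCov W x + t • linCov W d := by
  simp [linCov, add_smul, Finset.sum_add_distrib, Finset.smul_sum, mul_smul]

lemma linBudget_add_smul (e x d : J → ℝ) (t : ℝ) :
    linBudget e (x + t • d) = linBudget e x + t * linBudget e d := by
  simp [linBudget, add_mul, Finset.sum_add_distrib, Finset.mul_sum, mul_assoc]

lemma continuous_linCov (W : J → Matrix (Fin N) (Fin N) ℂ) : Continuous (linCov W) := by
  unfold linCov
  fun_prop

lemma continuous_linBudget (e : J → ℝ) : Continuous (linBudget e) := by
  unfold linBudget
  fun_prop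

/-- The regularised Lagrangian of the dual multiple access channel. -/
def lagr (K : ℕ) (h : ℕ → Fin N → ℂ) (a : ℕ → ℝ) (W : J → Matrix (Fin N) (Fin N) ℂ) (e : J → ℝ)
    (ε : ℝ) (x : J → ℝ) (p : ℕ → ℝ) : ℝ :=
  macWsr K h a (linCov W x) (fun k => linBudget e x * p k) -
    ε * ∑ k ∈ Finset.range K, p k ^ 2 - ε * logDet (linCov W x) + ε * ∑ j, x j

lemma continuous_macCov (h : ℕ → Fin N → ℂ) (W : J → Matrix (Fin N) (Fin N) ℂ) (e : J → ℝ)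
    (s : Finset ℕ) : Continuous fun z : (J → ℝ) × (ℕ → ℝ) =>
      macCov (linCov W z.1) h (fun k => linBudget e z.1 * z.2 k) s := by
  have h1 := continuous_linCov W
  have h2 := continuous_linBudget e
  unfold macCov
  fun_prop

/-- The pairs of multipliers and powers at which the dual channel is regular. -/
def dualDomain (W : J → Matrix (Fin N) (Fin N) ℂ) (e : J → ℝ) : Set ((J → ℝ) × (ℕ → ℝ)) :=
  {z | (linCov W z.1).PosDef ∧ 0 ≤ linBudget e z.1 ∧ ∀ k, 0 ≤ z.2 k}

lemma posDef_macCov_of_mem_dualDomain (h : ℕ → Fin N → ℂ) {W : J → Matrix (Fin N) (Fin N) ℂ}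
    {e : J → ℝ} {z : (J → ℝ) × (ℕ → ℝ)} (hz : z ∈ dualDomain W e) (s : Finset ℕ) :
    (macCov (linCov W z.1) h (fun k => linBudget e z.1 * z.2 k) s).PosDef :=
  posDef_macCov hz.1 h fun k _ => mul_nonneg hz.2.1 (hz.2.2 k)

lemma continuousOn_lagr (K : ℕ) (h : ℕ → Fin N → ℂ) (a : ℕ → ℝ)
    (W : J → Matrix (Fin N) (Fin N) ℂ) (e : J → ℝ) (ε : ℝ) :
    ContinuousOn (fun z : (J → ℝ) × (ℕ → ℝ) => lagr K h a W e ε z.1 z.2) (dualDomain W e) := by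
  have h0 : ContinuousOn (fun z : (J → ℝ) × (ℕ → ℝ) => logDet (linCov W z.1)) (dualDomain W e) :=
    continuousOn_logDet.comp ((continuous_linCov W).comp continuous_fst).continuousOn
      fun z hz => hz.1
  have h1 : ∀ s, ContinuousOn (fun z : (J → ℝ) × (ℕ → ℝ) =>
      logDet (macCov (linCov W z.1) h (fun k => linBudget e z.1 * z.2 k) s)) (dualDomain W e) :=
    fun s => continuousOn_logDet.comp (continuous_macCov h W e s).continuousOn
      fun z hz => posDef_macCov_of_mem_dualDomain h hz s
  unfold lagr macWsr
  refine ContinuousOn.add (ContinuousOn.sub (ContinuousOn.sub ?_ ?_) ?_) ?_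
  · exact continuousOn_finsetSum _ fun i _ => continuousOn_const.mul ((h1 _).sub h0)
  · fun_prop
  · exact continuousOn_const.mul h0
  · fun_prop

lemma continuousOn_macCov_inv (h : ℕ → Fin N → ℂ)
    (W : J → Matrix (Fin N) (Fin N) ℂ) (e : J → ℝ) (s : Finset ℕ) :
    ContinuousOn (fun z : (J → ℝ) × (ℕ → ℝ) =>
      (macCov (linCov W z.1) h (fun k => linBudget e z.1 * z.2 k) s)⁻¹) (dualDomain W e) :=
  continuousOn_inv_posDef.comp (continuous_macCov h W e s).continuousOn
      fun _ hz => posDef_macCov_of_mem_dualDomain h hz s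

lemma continuousOn_macGrad (K : ℕ) (h : ℕ → Fin N → ℂ) (a : ℕ → ℝ)
    (W : J → Matrix (Fin N) (Fin N) ℂ) (e : J → ℝ) (k : ℕ) :
    ContinuousOn (fun z : (J → ℝ) × (ℕ → ℝ) =>
      macGrad K h a (linCov W z.1) (fun k => linBudget e z.1 * z.2 k) k) (dualDomain W e) := by
  unfold macGrad
  exact continuousOn_finsetSum _ fun i _ => continuousOn_const.mul
    ((continuous_quad (h k)).comp_continuousOn (continuousOn_macCov_inv h W e _))

lemma continuousOn_macInv (K : ℕ) (h : ℕ → Fin N → ℂ) (a : ℕ → ℝ)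
    (W : J → Matrix (Fin N) (Fin N) ℂ) (e : J → ℝ) :
    ContinuousOn (fun z : (J → ℝ) × (ℕ → ℝ) =>
      macInv K h a (linCov W z.1) (fun k => linBudget e z.1 * z.2 k)) (dualDomain W e) := by
  unfold macInv
  exact continuousOn_finsetSum _ fun i _ =>
    (continuous_const_smul (a i - a (i + 1))).comp_continuousOn
      (continuousOn_macCov_inv h W e (Finset.range (i + 1)))

/-! ### Stationarity -/

section Stationarity

variable {K : ℕ} {h : ℕ → Fin N → ℂ} {a : ℕ → ℝ} {W : J → Matrix (Fin N) (Fin N) ℂ} {e : J → ℝ}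
  {ε : ℝ} {x : J → ℝ} {p : ℕ → ℝ}

/-- First-order optimality along the segment from `p` to `p'`: the Danskin lemma with one-point `Y`
and `Φ = -lagr`. -/
lemma sum_mul_sub_macGrad_le (ha : Antitone a) (haK : a K = 0)
    (hA : (linCov W x).PosDef) (hP : 0 ≤ linBudget e x) (hp : p ∈ powerSimplex K)
    (hmax : ∀ p' ∈ powerSimplex K, lagr K h a W e ε x p' ≤ lagr K h a W e ε x p)
    {p' : ℕ → ℝ} (hp' : p' ∈ powerSimplex K) :
    ∑ k ∈ Finset.range K, (p' k - p k) * (linBudget e x *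
      macGrad K h a (linCov W x) (fun k => linBudget e x * p k) k - 2 * ε * p k) ≤ 0 := by
  set P := linBudget e x with hPdef
  set A := linCov W x with hAdef
  set pt : ℝ → ℕ → ℝ := fun t => p + t • (p' - p) with hpt
  have hmem : ∀ t ∈ Set.Ico (0 : ℝ) 1, pt t ∈ powerSimplex K := fun t ht =>
    add_smul_sub_mem_powerSimplex hp hp' ht.1 ht.2.le
  have hdom : ∀ t ∈ Set.Ico (0 : ℝ) 1, (x, pt t) ∈ dualDomain W e := fun t ht =>
    ⟨hA, hP, (hmem t ht).1⟩
  have hptc : Continuous fun z : ℝ × Unit => (x, pt z.1) := by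
    simp only [hpt]
    fun_prop
  have key := nonneg_of_unique_max_of_min (D := (Set.univ : Set Unit)) isCompact_univ
    (τ := 1) one_pos (Φ := fun t _ => - lagr K h a W e ε x (pt t))
    -- Concavity bounds the value at `p` by the linearisation at the far point `pt t`, so the
    -- gradient is taken there; the last term is the exact difference quotient of the squares.
    (ψ := fun t _ => - ∑ k ∈ Finset.range K, (p' k - p k) *
      (P * macGrad K h a A (fun k => P * pt t k) k - ε * (2 * p k + t * (p' k - p k))))
    (p := ()) ?_ ?_ (fun _ _ => le_rfl) (fun _ _ _ => rfl) ?_ ?_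
  · have h0 : pt 0 = p := by simp [hpt]
    simp only [h0, zero_mul, add_zero] at key
    have h1 := neg_nonneg.1 key
    refine le_of_eq_of_le (Finset.sum_congr rfl fun k _ => ?_) h1
    ring
  · refine ContinuousOn.neg ?_
    exact ContinuousOn.comp (g := fun z : (J → ℝ) × (ℕ → ℝ) => lagr K h a W e ε z.1 z.2)
      (f := fun z : ℝ × Unit => (x, pt z.1)) (continuousOn_lagr K h a W e ε) hptc.continuousOn
      fun z hz => hdom z.1 hz.1
  · refine ContinuousOn.neg (continuousOn_finsetSum _ fun k _ => continuousOn_const.mul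
      (ContinuousOn.sub (continuousOn_const.mul ?_) ?_))
    · exact ContinuousOn.comp (f := fun z : ℝ × Unit => (x, pt z.1))
        (continuousOn_macGrad K h a W e k) hptc.continuousOn fun z hz => hdom z.1 hz.1
    · fun_prop
  · intro t ht
    refine ⟨(), trivial, ?_⟩
    have h0 : pt 0 = p := by simp [hpt]
    simp only [h0, neg_le_neg_iff]
    exact hmax _ (hmem t ⟨ht.1.le, ht.2⟩)
  · intro t ht _ _
    have h0 : pt 0 = p := by simp [hpt]
    have hpos := (hmem t ⟨ht.1.le, ht.2⟩).1
    have h1 := macWsr_sub_le h ha haK hA hA (q := fun k => P * pt t k) (q' := fun k => P * p k)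
      (fun k => mul_nonneg hP (hpos k)) (fun k => mul_nonneg hP (hp.1 k))
    simp only [sub_self, trMul_zero, mul_zero, add_zero, sub_zero] at h1
    simp only [h0, lagr, ← hPdef, ← hAdef]
    have h2 : ∑ k ∈ Finset.range K, (P * p k - P * pt t k) *
          macGrad K h a A (fun k => P * pt t k) k +
        ε * (∑ k ∈ Finset.range K, pt t k ^ 2 - ∑ k ∈ Finset.range K, p k ^ 2) =
        t * -∑ k ∈ Finset.range K, (p' k - p k) *
      (P * macGrad K h a A (fun k => P * pt t k) k - ε * (2 * p k + t * (p' k - p k))) := by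
      rw [← Finset.sum_sub_distrib, Finset.mul_sum, ← Finset.sum_add_distrib,
        ← Finset.sum_neg_distrib, Finset.mul_sum]
      refine Finset.sum_congr rfl fun k _ => ?_
      simp only [hpt, Pi.add_apply, Pi.smul_apply, Pi.sub_apply, smul_eq_mul]
      ring
    linarith

/-- Strict concavity: the linear part of the change is nonpositive by stationarity, and the penalty
leaves an extra `-ε ∑ (p' - p)²`. -/
lemma eq_of_lagr_le (ha : Antitone a) (haK : a K = 0) (hε : 0 < ε)
    (hA : (linCov W x).PosDef) (hP : 0 ≤ linBudget e x) (hp : p ∈ powerSimplex K)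
    (hmax : ∀ p' ∈ powerSimplex K, lagr K h a W e ε x p' ≤ lagr K h a W e ε x p)
    {p' : ℕ → ℝ} (hp' : p' ∈ powerSimplex K)
    (hle : lagr K h a W e ε x p ≤ lagr K h a W e ε x p') : p' = p := by
  have h1 := sum_mul_sub_macGrad_le ha haK hA hP hp hmax hp'
  have h2 := macWsr_sub_le h ha haK hA hA (q := fun k => linBudget e x * p k)
    (q' := fun k => linBudget e x * p' k)
    (fun k => mul_nonneg hP (hp.1 k)) (fun k => mul_nonneg hP (hp'.1 k))
  simp only [sub_self, trMul_zero, mul_zero, add_zero, sub_zero] at h2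
  simp only [lagr] at hle
  have h3 : ∑ k ∈ Finset.range K, (linBudget e x * p' k - linBudget e x * p k) *
        macGrad K h a (linCov W x) (fun k => linBudget e x * p k) k -
      ε * (∑ k ∈ Finset.range K, p' k ^ 2 - ∑ k ∈ Finset.range K, p k ^ 2) =
      ∑ k ∈ Finset.range K, (p' k - p k) * (linBudget e x *
      macGrad K h a (linCov W x) (fun k => linBudget e x * p k) k - 2 * ε * p k) -
      ε * ∑ k ∈ Finset.range K, (p' k - p k) ^ 2 := by
    rw [← Finset.sum_sub_distrib, Finset.mul_sum, ← Finset.sum_sub_distrib, Finset.mul_sum,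
      ← Finset.sum_sub_distrib]
    exact Finset.sum_congr rfl fun k _ => by ring
  have h4 : ε * ∑ k ∈ Finset.range K, (p' k - p k) ^ 2 ≤ 0 := by linarith
  have h5 : ∑ k ∈ Finset.range K, (p' k - p k) ^ 2 = 0 :=
    le_antisymm (nonpos_of_mul_nonpos_right h4 hε) (Finset.sum_nonneg fun k _ => sq_nonneg _)
  funext k
  by_cases hk : k < K
  · have h6 := (Finset.sum_eq_zero_iff_of_nonneg fun k _ => sq_nonneg (p' k - p k)).1 h5 k
      (Finset.mem_range.2 hk)
    exact sub_eq_zero.1 (pow_eq_zero_iff two_ne_zero |>.1 h6)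
  · rw [hp.2.1 k (not_lt.1 hk), hp'.2.1 k (not_lt.1 hk)]

/-- First-order optimality of the multipliers in the direction `d`. As the maximising power vector
is unique, the derivative can be computed with `p` frozen. -/
lemma trMul_linCov_le_of_min (ha : Antitone a) (haK : a K = 0) (hε : 0 < ε)
    (hp : p ∈ powerSimplex K)
    (hmax : ∀ p' ∈ powerSimplex K, lagr K h a W e ε x p' ≤ lagr K h a W e ε x p)
    {d : J → ℝ} {τ : ℝ} (hτ : 0 < τ)
    (hA : ∀ t ∈ Set.Ico 0 τ, (linCov W (x + t • d)).PosDef)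
    (hP : ∀ t ∈ Set.Ico 0 τ, 0 ≤ linBudget e (x + t • d))
    (hmin : ∀ t ∈ Set.Ioo 0 τ, ∃ p' ∈ powerSimplex K,
      lagr K h a W e ε x p ≤ lagr K h a W e ε (x + t • d) p') :
    trMul (a 0 • (linCov W x)⁻¹ -
        macInv K h a (linCov W x) (fun k => linBudget e x * p k) + ε • (linCov W x)⁻¹)
        (linCov W d) ≤
      linBudget e d * ∑ k ∈ Finset.range K, p k *
        macGrad K h a (linCov W x) (fun k => linBudget e x * p k) k + ε * ∑ j, d j := by
  have hx0 : x + (0 : ℝ) • d = x := by simp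
  have h0mem : (0 : ℝ) ∈ Set.Ico 0 τ := ⟨le_rfl, hτ⟩
  have hA0 : (linCov W x).PosDef := by simpa [hx0] using hA 0 h0mem
  have hP0 : 0 ≤ linBudget e x := by simpa [hx0] using hP 0 h0mem
  have hdom : ∀ z ∈ Set.Ico 0 τ ×ˢ powerSimplex K, (x + z.1 • d, z.2) ∈ dualDomain W e :=
    fun z hz => ⟨hA _ hz.1, hP _ hz.1, hz.2.1⟩
  have hdom0 : ∀ z ∈ Set.Ico 0 τ ×ˢ powerSimplex K, (x, z.2) ∈ dualDomain W e :=
    fun z hz => ⟨hA0, hP0, hz.2.1⟩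
  have hc1 : Continuous fun z : ℝ × (ℕ → ℝ) => (x + z.1 • d, z.2) := by fun_prop
  have hc2 : Continuous fun z : ℝ × (ℕ → ℝ) => (x, z.2) := by fun_prop
  have key := nonneg_of_unique_max_of_min (isCompact_powerSimplex K) hτ
    (Φ := fun t y => lagr K h a W e ε (x + t • d) y)
    -- The concave log dets are linearised at `x`. The convex term `-(a 0 + ε) log det` is bounded
    -- by its slope at the far point `x + t • d`, which is why `t` enters `ψ`.
    (ψ := fun t y => linBudget e d * ∑ k ∈ Finset.range K, y k *
        macGrad K h a (linCov W x) (fun k => linBudget e x * y k) k +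
      trMul (macInv K h a (linCov W x) (fun k => linBudget e x * y k)) (linCov W d) -
      (a 0 + ε) * trMul (linCov W (x + t • d))⁻¹ (linCov W d) + ε * ∑ j, d j) (p := p)
    ?_ ?_ ?_ ?_ ?_ ?_
  · rw [hx0] at key
    simp only [add_trMul, sub_trMul, smul_trMul]
    linarith
  · exact ContinuousOn.comp (g := fun z : (J → ℝ) × (ℕ → ℝ) => lagr K h a W e ε z.1 z.2)
      (f := fun z : ℝ × (ℕ → ℝ) => (x + z.1 • d, z.2)) (continuousOn_lagr K h a W e ε)
      hc1.continuousOn hdom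
  · refine ContinuousOn.add (ContinuousOn.sub (ContinuousOn.add (continuousOn_const.mul
      (continuousOn_finsetSum _ fun k _ => ContinuousOn.mul ?_ ?_)) ?_)
      (continuousOn_const.mul ?_)) continuousOn_const
    · fun_prop
    · exact ContinuousOn.comp (f := fun z : ℝ × (ℕ → ℝ) => (x, z.2))
        (continuousOn_macGrad K h a W e k) hc2.continuousOn hdom0
    · have hc4 : ContinuousOn (fun z : ℝ × (ℕ → ℝ) =>
          macInv K h a (linCov W x) (fun k => linBudget e x * z.2 k))
          (Set.Ico 0 τ ×ˢ powerSimplex K) :=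
        ContinuousOn.comp (g := fun z : (J → ℝ) × (ℕ → ℝ) =>
          macInv K h a (linCov W z.1) (fun k => linBudget e z.1 * z.2 k))
          (f := fun z : ℝ × (ℕ → ℝ) => (x, z.2))
          (continuousOn_macInv K h a W e) hc2.continuousOn hdom0
      exact (continuous_trMul_left (linCov W d)).comp_continuousOn hc4
    · have hc3 : ContinuousOn (fun z : ℝ × (ℕ → ℝ) => (linCov W (x + z.1 • d))⁻¹)
          (Set.Ico 0 τ ×ˢ powerSimplex K) :=
        ContinuousOn.comp (f := fun z : ℝ × (ℕ → ℝ) => linCov W (x + z.1 • d))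
          continuousOn_inv_posDef
          (((continuous_linCov W).comp continuous_fst).comp hc1).continuousOn
          fun z hz => hA _ hz.1
      exact (continuous_trMul_left (linCov W d)).comp_continuousOn hc3
  · intro y hy
    simpa only [hx0] using hmax y hy
  · intro y hy hle
    simp only [hx0] at hle
    exact eq_of_lagr_le ha haK hε hA0 hP0 hp hmax hy hle
  · intro t ht
    simpa only [hx0] using hmin t ht
  · intro t ht y hy
    have htm : t ∈ Set.Ico 0 τ := ⟨ht.1.le, ht.2⟩
    have hAt := hA t htm
    have h1 := macWsr_sub_le h ha haK hA0 hAt (q := fun k => linBudget e x * y k)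
      (q' := fun k => linBudget e (x + t • d) * y k)
      (fun k => mul_nonneg hP0 (hy.1 k)) (fun k => mul_nonneg (hP t htm) (hy.1 k))
    have h2 := logDet_sub_le hAt hA0
    have h3 : linCov W (x + t • d) - linCov W x = t • linCov W d := by
      rw [linCov_add_smul]; abel
    have h3' : linCov W x - linCov W (x + t • d) = (-t) • linCov W d := by
      rw [linCov_add_smul, neg_smul]; abel
    rw [h3, trMul_smul] at h1
    rw [h3', trMul_smul] at h2
    have h4 : ∑ k ∈ Finset.range K, (linBudget e (x + t • d) * y k - linBudget e x * y k) *
        macGrad K h a (linCov W x) (fun k => linBudget e x * y k) k =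
        t * (linBudget e d * ∑ k ∈ Finset.range K, y k *
        macGrad K h a (linCov W x) (fun k => linBudget e x * y k) k) := by
      rw [Finset.mul_sum, Finset.mul_sum]
      refine Finset.sum_congr rfl fun k _ => ?_
      rw [linBudget_add_smul]
      ring
    have h5 : ∑ j, (x + t • d) j = ∑ j, x j + t * ∑ j, d j := by
      simp [Finset.sum_add_distrib, Finset.mul_sum]
    have ha0 : 0 ≤ a 0 := by rw [← haK]; exact ha (Nat.zero_le K)
    have h6 := mul_le_mul_of_nonneg_left h2 (by linarith : 0 ≤ a 0 + ε)
    simp only [hx0, lagr]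
    rw [h4] at h1
    rw [h5]
    linarith

end Stationarity

/-! ### Existence of a regularised saddle point -/

/-- Linear constraints `Tr(Q W j) ≤ e j` that contain a total power constraint, are feasible, and
whose matrices may be added in small multiples to positive definite matrices. -/
structure IsPowerSystem (W : J → Matrix (Fin N) (Fin N) ℂ) (e : J → ℝ) : Prop where
  exists_one : ∃ j, W j = 1
  posDef_add : ∀ j A, A.PosDef → ∃ τ : ℝ, 0 < τ ∧ ∀ t ∈ Set.Ico 0 τ, (A + t • W j).PosDef
  feasible : ∃ Q : Matrix (Fin N) (Fin N) ℂ, (∀ j, trMul Q (W j) ≤ e j) ∧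
    ∀ A : Matrix (Fin N) (Fin N) ℂ, A.PosDef → 0 < trMul Q A

lemma trMul_linCov (A : Matrix (Fin N) (Fin N) ℂ) (W : J → Matrix (Fin N) (Fin N) ℂ)
    (x : J → ℝ) : trMul A (linCov W x) = ∑ j, x j * trMul A (W j) := by
  simp [linCov]

lemma linCov_single [DecidableEq J] (W : J → Matrix (Fin N) (Fin N) ℂ) (j : J) :
    linCov W (Pi.single j 1) = W j := by
  rw [linCov, Finset.sum_eq_single j]
  · simp
  · intro i _ hi; simp [hi]
  · simp

lemma linBudget_single [DecidableEq J] (e : J → ℝ) (j : J) :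
    linBudget e (Pi.single j 1) = e j := by
  simp [linBudget, Pi.single_apply]

lemma linBudget_pos {W : J → Matrix (Fin N) (Fin N) ℂ} {e : J → ℝ} (hs : IsPowerSystem W e)
    {x : J → ℝ} (hx : ∀ j, 0 ≤ x j) (hA : (linCov W x).PosDef) : 0 < linBudget e x := by
  obtain ⟨Q, hQ, hpos⟩ := hs.feasible
  refine (hpos _ hA).trans_le ?_
  rw [trMul_linCov]
  exact Finset.sum_le_sum fun j _ => mul_le_mul_of_nonneg_left (hQ j) (hx j)

/-- The tangent to log det at `2c · 1`, with `c` bounding the traces of all `W j`. The slope 1/2,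
less than 1, makes `∑ x - log det` coercive. -/
lemma exists_logDet_linCov_le (W : J → Matrix (Fin N) (Fin N) ℂ) :
    ∃ C : ℝ, ∀ x : J → ℝ, (∀ j, 0 ≤ x j) → (linCov W x).PosDef →
      logDet (linCov W x) ≤ C + (∑ j, x j) / 2 := by
  obtain ⟨c, hc0, hcW⟩ : ∃ c : ℝ, 0 < c ∧ ∀ j, trMul 1 (W j) ≤ c := by
    have h0 : 0 ≤ ∑ j, |trMul 1 (W j)| := Finset.sum_nonneg fun j _ => abs_nonneg _
    refine ⟨∑ j, |trMul 1 (W j)| + 1, by linarith, fun j => (le_abs_self _).trans ?_⟩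
    have := Finset.single_le_sum (f := fun j => |trMul 1 (W j)|) (fun i _ => abs_nonneg _)
      (Finset.mem_univ j)
    linarith
  set B : Matrix (Fin N) (Fin N) ℂ := (2 * c) • 1 with hB
  have hBpos : B.PosDef := by
    have : B = ((2 * c : ℝ) : ℂ) • 1 := by rw [hB]; ext; simp
    rw [this]
    exact Matrix.PosDef.one.smul (by exact_mod_cast (by linarith : (0 : ℝ) < 2 * c))
  have hBinv : B⁻¹ = (2 * c)⁻¹ • 1 := by
    apply Matrix.inv_eq_right_inv
    rw [hB, Matrix.smul_mul, Matrix.one_mul, smul_smul,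
      mul_inv_cancel₀ (mul_pos two_pos hc0).ne', one_smul]
  refine ⟨logDet B, fun x hx hA => ?_⟩
  have h1 := logDet_sub_le hBpos hA
  have h2 : trMul 1 (linCov W x) ≤ c * ∑ j, x j := by
    rw [trMul_linCov, Finset.mul_sum]
    refine Finset.sum_le_sum fun j _ => ?_
    rw [mul_comm]
    exact mul_le_mul_of_nonneg_right (hcW j) (hx j)
  have h3 : trMul B⁻¹ (linCov W x) ≤ (∑ j, x j) / 2 := by
    rw [hBinv, smul_trMul, inv_mul_le_iff₀ (by linarith)]
    linarith
  have h4 := trMul_nonneg hBpos.inv.posSemidef hBpos.posSemidef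
  rw [trMul_sub] at h1
  linarith

lemma exists_saddle {K : ℕ} (hK : 1 ≤ K) (h : ℕ → Fin N → ℂ) {a : ℕ → ℝ} (ha : Antitone a)
    {W : J → Matrix (Fin N) (Fin N) ℂ} {e : J → ℝ} (hs : IsPowerSystem W e) {ε : ℝ} (hε : 0 < ε) :
    ∃ x : J → ℝ, ∃ p ∈ powerSimplex K, (∀ j, 0 ≤ x j) ∧ (linCov W x).PosDef ∧
      (∀ p' ∈ powerSimplex K, lagr K h a W e ε x p' ≤ lagr K h a W e ε x p) ∧
      ∀ x' : J → ℝ, (∀ j, 0 ≤ x' j) → (linCov W x').PosDef →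
        ∃ p' ∈ powerSimplex K, lagr K h a W e ε x p ≤ lagr K h a W e ε x' p' := by
  classical
  obtain ⟨j₀, hj₀⟩ := hs.exists_one
  obtain ⟨C, hC⟩ := exists_logDet_linCov_le W
  have hmemD : ∀ x : J → ℝ, (∀ j, 0 ≤ x j) → (linCov W x).PosDef → ∀ p ∈ powerSimplex K,
      (x, p) ∈ dualDomain W e := fun x hx hA p hp => ⟨hA, (linBudget_pos hs hx hA).le, hp.1⟩
  set p₀ : ℕ → ℝ := Pi.single 0 1 with hp₀
  have hp₀mem : p₀ ∈ powerSimplex K := single_mem_powerSimplex hK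
  set x₀ : J → ℝ := Pi.single j₀ 1 with hx₀
  have hx₀pos : ∀ j, 0 ≤ x₀ j := by
    intro j
    by_cases hj : j = j₀
    · subst hj; simp [hx₀]
    · simp [hx₀, hj]
  have hA₀ : (linCov W x₀).PosDef := by
    rw [hx₀, linCov_single, hj₀]; exact Matrix.PosDef.one
  obtain ⟨pm, hpm, hpmmax⟩ := (isCompact_powerSimplex K).exists_isMaxOn ⟨p₀, hp₀mem⟩
    (f := fun p => lagr K h a W e ε x₀ p)
    (ContinuousOn.comp (g := fun z : (J → ℝ) × (ℕ → ℝ) => lagr K h a W e ε z.1 z.2)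
      (f := fun p : ℕ → ℝ => (x₀, p)) (continuousOn_lagr K h a W e ε)
      (by fun_prop) fun p hp => hmemD x₀ hx₀pos hA₀ p hp)
  set M := lagr K h a W e ε x₀ pm with hM
  have hMmax : ∀ p ∈ powerSimplex K, lagr K h a W e ε x₀ p ≤ M := fun p hp => hpmmax hp
  -- If the value at `p₀` is at most `M`, then `macWsr ≥ 0` and `∑ p₀² ≤ 1` give `∑ x - log det ≤
  -- M₁`. Hence `log det ≥ -M₁`, and the bound `log det ≤ C + (∑ x) / 2` gives `∑ x ≤ R`.
  set M₁ := M / ε + 1 with hM₁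
  set R := 2 * (M₁ + C) with hR
  set S : Set (J → ℝ) := {x | (∀ j, 0 ≤ x j) ∧ ∑ j, x j ≤ R ∧ (linCov W x).PosSemidef ∧
    Real.exp (-M₁) ≤ (linCov W x).det.re} with hS
  have hSpos : ∀ x ∈ S, (linCov W x).PosDef := by
    intro x hx
    refine hx.2.2.1.posDef_iff_det_ne_zero.2 fun h0 => ?_
    have h1 := hx.2.2.2
    rw [h0] at h1
    exact absurd h1 (not_le.2 (Real.exp_pos _))
  have hSmem : ∀ x : J → ℝ, (∀ j, 0 ≤ x j) → (linCov W x).PosDef →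
      (∀ p ∈ powerSimplex K, lagr K h a W e ε x p ≤ M) → x ∈ S := by
    intro x hx hA hle
    have h1 := hle p₀ hp₀mem
    have h2 := macWsr_nonneg K h ha hA (q := fun k => linBudget e x * p₀ k)
      fun k => mul_nonneg (linBudget_pos hs hx hA).le (hp₀mem.1 k)
    have h3 := mul_le_mul_of_nonneg_left (sum_sq_le_one_of_mem_powerSimplex hp₀mem) hε.le
    rw [lagr] at h1
    have h4 : ε * (∑ j, x j - logDet (linCov W x)) ≤ ε * M₁ := by
      rw [hM₁, mul_add, mul_div_cancel₀ _ hε.ne']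
      linarith
    have h5 := le_of_mul_le_mul_left h4 hε
    have h6 := hC x hx hA
    have h7 : 0 ≤ ∑ j, x j := Finset.sum_nonneg fun j _ => hx j
    refine ⟨hx, by rw [hR]; linarith, hA.posSemidef, ?_⟩
    rw [← Real.le_log_iff_exp_le (det_re_pos hA)]
    change -M₁ ≤ logDet (linCov W x)
    linarith
  have hx₀S : x₀ ∈ S := hSmem x₀ hx₀pos hA₀ hMmax
  have hScompact : IsCompact S := by
    refine (isCompact_univ_pi fun _ : J => isCompact_Icc (a := (0 : ℝ)) (b := R)).of_isClosed_subset
      ?_ fun x hx j _ => ⟨hx.1 j, (Finset.single_le_sum (fun i _ => hx.1 i)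
        (Finset.mem_univ j)).trans hx.2.1⟩
    have hSeq : S = (⋂ j, {x : J → ℝ | 0 ≤ x j}) ∩ ({x | ∑ j, x j ≤ R} ∩
        (linCov W ⁻¹' {A | A.PosSemidef} ∩ {x | Real.exp (-M₁) ≤ (linCov W x).det.re})) := by
      ext x
      simp [hS]
    rw [hSeq]
    have hcd : Continuous fun x => (linCov W x).det.re :=
      Complex.continuous_re.comp (continuous_linCov W).matrix_det
    exact (isClosed_iInter fun j => isClosed_le continuous_const (continuous_apply j)).inter
      ((isClosed_le (by fun_prop) continuous_const).inter
        ((isClosed_posSemidef.preimage (continuous_linCov W)).inter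
          (isClosed_le continuous_const hcd)))
  obtain ⟨x, hx, p, hp, hmax, hmin⟩ := exists_minimax hScompact ⟨x₀, hx₀S⟩
    (isCompact_powerSimplex K) ⟨p₀, hp₀mem⟩ (Φ := fun x p => lagr K h a W e ε x p)
    ((continuousOn_lagr K h a W e ε).mono fun z hz => hmemD z.1 hz.1.1 (hSpos z.1 hz.1) z.2 hz.2)
  refine ⟨x, p, hp, hx.1, hSpos x hx, hmax, fun x' hx' hA' => ?_⟩
  by_cases hx'S : x' ∈ S
  · exact hmin x' hx'S
  -- Outside `S` some power vector gives a value above `M`, while the minimax value over `S` is at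
  -- most `M` because `x₀ ∈ S`.
  · by_contra! hcon
    refine hx'S (hSmem x' hx' hA' fun p' hp' => ?_)
    obtain ⟨p₁, hp₁, hle₁⟩ := hmin x₀ hx₀S
    exact (hcon p' hp').le.trans (hle₁.trans (hMmax p₁ hp₁))

/-! ### From the multiple access channel to the broadcast channel -/

/-- The broadcast covariance of user `i` derived from a stationary point of the multiple access
channel. -/
def bcCov (h : ℕ → Fin N → ℂ) (a : ℕ → ℝ) (A : Matrix (Fin N) (Fin N) ℂ) (q : ℕ → ℝ) (i : ℕ) :
    Matrix (Fin N) (Fin N) ℂ :=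
  a i • ((macCov A h q (Finset.range i))⁻¹ - (macCov A h q (Finset.range (i + 1)))⁻¹)

/-- Summation by parts. It serves both for the total covariance and for the interference that a user
sees from those encoded later. -/
lemma sum_Ico_bcCov (h : ℕ → Fin N → ℂ) (a : ℕ → ℝ) (A : Matrix (Fin N) (Fin N) ℂ) (q : ℕ → ℝ)
    {i m : ℕ} (him : i ≤ m) :
    ∑ k ∈ Finset.Ico i m, bcCov h a A q k = a i • (macCov A h q (Finset.range i))⁻¹ -
      ∑ k ∈ Finset.Ico i m, (a k - a (k + 1)) • (macCov A h q (Finset.range (k + 1)))⁻¹ -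
      a m • (macCov A h q (Finset.range m))⁻¹ := by
  induction m, him using Nat.le_induction with
  | base => simp
  | succ m him ih =>
    rw [Finset.sum_Ico_succ_top him, ih, Finset.sum_Ico_succ_top him, bcCov]
    module

lemma posSemidef_bcCov (h : ℕ → Fin N → ℂ) {a : ℕ → ℝ} {i : ℕ} (ha : 0 ≤ a i)
    {A : Matrix (Fin N) (Fin N) ℂ} (hA : A.PosDef) {q : ℕ → ℝ} (hq : ∀ k, 0 ≤ q k) :
    (bcCov h a A q i).PosSemidef :=
  posSemidef_smul (posSemidef_inv_sub_inv (posDef_macCov hA h fun k _ => hq k)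
    (posDef_macCov hA h fun k _ => hq k) (posSemidef_macCov_sub A h
      (Finset.range_subset_range.2 (Nat.le_succ i)) fun k _ => hq k)) ha

lemma quad_smul (t : ℝ) (A : Matrix (Fin N) (Fin N) ℂ) (v : Fin N → ℂ) :
    quad (t • A) v = t * quad A v := by
  rw [← trMul_outer, smul_trMul, trMul_outer]

lemma quad_sub (A B : Matrix (Fin N) (Fin N) ℂ) (v : Fin N → ℂ) :
    quad (A - B) v = quad A v - quad B v := by
  simp only [← trMul_outer, sub_trMul]

/-- Let `x`, `y` be the quadratic forms of the inverse covariance at `h i` before and after adding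
user `i`. Up to the factor `κ⁻¹`, the signal is `s = a i (x - y) = a i y q x` and the interference
is `t = a i y - macGrad`. So `κ ≤ macGrad` gives `s / (κ + t) ≥ q x`, the SINR in the MAC. For `q i
= 0` the MAC rate is zero. -/
lemma logDet_macCov_sub_le_bcRate {K : ℕ} (h : ℕ → Fin N → ℂ) {a : ℕ → ℝ} (ha : Antitone a)
    (haK : a K = 0) {A : Matrix (Fin N) (Fin N) ℂ} (hA : A.PosDef) {q : ℕ → ℝ}
    (hq : ∀ k, 0 ≤ q k) {κ : ℝ} (hκ : 0 < κ) {i : ℕ} (hi : i < K)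
    (hgrad : 0 < q i → κ ≤ macGrad K h a A q i) :
    logDet (macCov A h q (Finset.range (i + 1))) - logDet (macCov A h q (Finset.range i)) ≤
      bcRate K h (fun k => κ⁻¹ • bcCov h a A q k) i := by
  have hai : ∀ k, k ≤ K → 0 ≤ a k := fun k hk => by rw [← haK]; exact ha hk
  set B := macCov A h q (Finset.range i) with hB
  have hBpos : B.PosDef := posDef_macCov hA h fun k _ => hq k
  have hstep : macCov A h q (Finset.range (i + 1)) = B + q i • outer (h i) := by
    rw [Finset.range_add_one, macCov_insert A h q Finset.notMem_range_self]
  set T : Matrix (Fin N) (Fin N) ℂ := ∑ k ∈ Finset.Ico (i + 1) K, bcCov h a A q k with hT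
  have hTpos : T.PosSemidef := Matrix.posSemidef_sum _ fun k hk =>
    posSemidef_bcCov h (hai k (Finset.mem_Ico.1 hk).2.le) hA hq
  have hSpos : (bcCov h a A q i).PosSemidef := posSemidef_bcCov h (hai i hi.le) hA hq
  set s := quad (bcCov h a A q i) (h i) with hs
  set t := quad T (h i) with ht
  have hs0 : 0 ≤ s := quad_nonneg hSpos _
  have ht0 : 0 ≤ t := quad_nonneg hTpos _
  have hrate : bcRate K h (fun k => κ⁻¹ • bcCov h a A q k) i = Real.log ((κ + t + s) / (κ + t)) := by
    rw [bcRate, ← Finset.smul_sum, ← Finset.smul_sum, quad_smul, quad_smul,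
      Finset.sum_eq_sum_Ico_succ_bot hi, ← hT, ← ht,
      show quad (bcCov h a A q i + T) (h i) = s + t by
        rw [hs, ht, ← trMul_outer, add_trMul, trMul_outer, trMul_outer]]
    congr 1
    field_simp
    ring
  have hx0 := quad_nonneg hBpos.inv.posSemidef (h i)
  rw [hrate, hstep, logDet_add_smul_outer hBpos _ (hq i), add_sub_cancel_left]
  refine Real.log_le_log (by have := mul_nonneg (hq i) hx0; linarith) ?_
  rw [le_div_iff₀ (by linarith)]
  rcases (hq i).eq_or_lt with h0 | h0
  · rw [← h0]; linarith
  · have hκle := hgrad h0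
    set y := quad (B + q i • outer (h i))⁻¹ (h i) with hy
    set x := quad B⁻¹ (h i) with hx
    have hxy : y * (1 + q i * x) = x := quad_inv_add_smul_outer hBpos (h i) (hq i)
    have hsxy : s = a i * (x - y) := by
      rw [hs, bcCov, ← hB, hstep, quad_smul, quad_sub]
    have htg : t = a i * y - macGrad K h a A q i := by
      have h1 := sum_Ico_bcCov h a A q (Nat.succ_le_of_lt hi)
      rw [haK, zero_smul, sub_zero] at h1
      rw [ht, hT, h1, quad_sub, quad_smul, hstep, quad_sum, macGrad,
        Finset.sum_eq_sum_Ico_succ_bot hi, hstep]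
      simp only [quad_smul, Nat.succ_eq_add_one]
      ring
    have h2 : s = a i * y * (q i * x) := by rw [hsxy]; linear_combination (-(a i)) * hxy
    have h3 : κ + t ≤ a i * y := by linarith
    have h4 := mul_le_mul_of_nonneg_right h3 (mul_nonneg (hq i) hx0)
    linarith

lemma macWsr_le_sum_bcRate {K : ℕ} (h : ℕ → Fin N → ℂ) {a : ℕ → ℝ} (ha : Antitone a)
    (haK : a K = 0) {A : Matrix (Fin N) (Fin N) ℂ} (hA : A.PosDef) {q : ℕ → ℝ}
    (hq : ∀ k, 0 ≤ q k) {κ : ℝ} (hκ : 0 < κ)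
    (hgrad : ∀ i < K, 0 < q i → κ ≤ macGrad K h a A q i) :
    macWsr K h a A q ≤
      ∑ i ∈ Finset.range K, a i * bcRate K h (fun k => κ⁻¹ • bcCov h a A q k) i := by
  have h1 : macWsr K h a A q = ∑ i ∈ Finset.range K, a i *
      (logDet (macCov A h q (Finset.range (i + 1))) - logDet (macCov A h q (Finset.range i))) := by
    rw [sum_range_mul_eq_by_parts, haK, zero_mul, add_zero, macWsr]
    refine Finset.sum_congr rfl fun i _ => ?_
    rw [Finset.sum_range_sub (fun k => logDet (macCov A h q (Finset.range k)))]
    simp [macCov_empty]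
  rw [h1]
  refine Finset.sum_le_sum fun i hi => mul_le_mul_of_nonneg_left ?_ ?_
  · have hiK := Finset.mem_range.1 hi
    exact logDet_macCov_sub_le_bcRate h ha haK hA hq hκ hiK (hgrad i hiK)
  · rw [← haK]; exact ha (Finset.mem_range.1 hi).le

/-! ### Near-optimal broadcast points -/

/-- Some `y i` with positive weight must reach a fixed level `w`, and its term alone suffices. The
bound `δ` depends only on `c`, `K` and `v`, so it can be fixed before the regularisation parameter.
-/
lemma exists_le_sum_mul_one_sub_exp (K : ℕ) {c : ℕ → ℝ} (hc : ∀ i, 0 ≤ c i) {v : ℝ} (hv : 0 < v) :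
    ∃ δ : ℝ, 0 < δ ∧ ∀ y : ℕ → ℝ, (∀ i, 0 ≤ y i) → v ≤ ∑ i ∈ Finset.range K, c i * y i →
      δ ≤ ∑ i ∈ Finset.range K, c i * (1 - Real.exp (-y i)) := by
  obtain ⟨m, hm, hmc⟩ : ∃ m : ℝ, 0 < m ∧ ∀ i ∈ Finset.range K, 0 < c i → m ≤ c i := by
    induction K with
    | zero => exact ⟨1, one_pos, by simp⟩
    | succ K ih =>
      obtain ⟨m, hm, hmc⟩ := ih
      by_cases hK : 0 < c K
      · refine ⟨min m (c K), lt_min hm hK, fun i hi hci => ?_⟩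
        rcases Finset.mem_insert.1 (Finset.range_add_one ▸ hi) with rfl | hi
        · exact min_le_right _ _
        · exact (min_le_left _ _).trans (hmc i hi hci)
      · refine ⟨m, hm, fun i hi hci => ?_⟩
        rcases Finset.mem_insert.1 (Finset.range_add_one ▸ hi) with rfl | hi
        · exact absurd hci hK
        · exact hmc i hi hci
  set C := ∑ i ∈ Finset.range K, c i with hC
  have hC0 : 0 ≤ C := Finset.sum_nonneg fun i _ => hc i
  -- The summand 1 makes `w * C < v` strict and allows `C = 0`.
  set w := v / (C + 1) with hw
  have hw0 : 0 < w := div_pos hv (by linarith)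
  have hwC : w * C + w = v := by rw [hw]; field_simp
  have hexp : ∀ t : ℝ, 0 ≤ t → 0 ≤ 1 - Real.exp (-t) := fun t ht =>
    sub_nonneg.2 (Real.exp_le_one_iff.2 (neg_nonpos.2 ht))
  have hew : 0 < 1 - Real.exp (-w) := sub_pos.2 (Real.exp_lt_one_iff.2 (neg_lt_zero.2 hw0))
  refine ⟨m * (1 - Real.exp (-w)), mul_pos hm hew, fun y hy hvy => ?_⟩
  obtain ⟨i, hi, hci, hyi⟩ : ∃ i ∈ Finset.range K, 0 < c i ∧ w ≤ y i := by
    by_contra! hcon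
    have h1 : ∑ i ∈ Finset.range K, c i * y i ≤ ∑ i ∈ Finset.range K, c i * w := by
      refine Finset.sum_le_sum fun i hi => ?_
      rcases (hc i).eq_or_lt with h0 | h0
      · rw [← h0]; simp
      · exact mul_le_mul_of_nonneg_left (hcon i hi h0).le h0.le
    rw [← Finset.sum_mul, ← hC] at h1
    linarith [mul_comm C w]
  have h1 : c i * (1 - Real.exp (-y i)) ≤ ∑ i ∈ Finset.range K, c i * (1 - Real.exp (-y i)) :=
    Finset.single_le_sum (f := fun i => c i * (1 - Real.exp (-y i)))
      (fun i _ => mul_nonneg (hc i) (hexp _ (hy i))) hi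
  refine le_trans ?_ h1
  exact mul_le_mul (hmc i hi hci) (by have := Real.exp_le_exp.2 (neg_le_neg hyi); linarith)
    hew.le (hc i)

/-- Euler's identity for the invariance of `macWsr` under joint scaling of `A` and `q`. -/
lemma trMul_sub_macInv {K : ℕ} (h : ℕ → Fin N → ℂ) {a : ℕ → ℝ} (haK : a K = 0)
    {A : Matrix (Fin N) (Fin N) ℂ} (hA : A.PosDef) {q : ℕ → ℝ} (hq : ∀ k, 0 ≤ q k) :
    trMul (a 0 • A⁻¹ - macInv K h a A q) A =
      ∑ k ∈ Finset.range K, q k * macGrad K h a A q k := by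
  rw [← sum_trMul_inv_eq_sum_macGrad, sub_trMul, smul_trMul, trMul_inv_self hA, macInv, sum_trMul,
    ← sum_weight_sub haK, Finset.sum_mul, ← Finset.sum_sub_distrib]
  refine Finset.sum_congr rfl fun i _ => ?_
  have h1 := trMul_inv_self (posDef_macCov hA h (q := q) (s := Finset.range (i + 1))
    fun k _ => hq k)
  have h2 : ∑ k ∈ Finset.range (i + 1), q k • outer (h k) =
      macCov A h q (Finset.range (i + 1)) - A := by
    simp [macCov]
  rw [smul_trMul, h2, trMul_sub, h1]
  ring

lemma sum_one_sub_exp_le_sum_macGrad {K : ℕ} (h : ℕ → Fin N → ℂ) {a : ℕ → ℝ} (ha : Antitone a)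
    {A : Matrix (Fin N) (Fin N) ℂ} (hA : A.PosDef) {q : ℕ → ℝ} (hq : ∀ k, 0 ≤ q k) :
    ∑ i ∈ Finset.range K, (a i - a (i + 1)) *
        (1 - Real.exp (-(logDet (macCov A h q (Finset.range (i + 1))) - logDet A))) ≤
      ∑ k ∈ Finset.range K, q k * macGrad K h a A q k := by
  rw [← sum_trMul_inv_eq_sum_macGrad]
  refine Finset.sum_le_sum fun i _ =>
    mul_le_mul_of_nonneg_left ?_ (sub_nonneg.2 (ha (Nat.le_succ i)))
  have h2 : ∑ k ∈ Finset.range (i + 1), q k • outer (h k) =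
      macCov A h q (Finset.range (i + 1)) - A := by
    simp [macCov]
  have h3 := posSemidef_sum_smul_outer h (q := q) (s := Finset.range (i + 1)) fun k _ => hq k
  rw [h2] at h3 ⊢
  exact one_sub_exp_le_trMul hA (posDef_macCov hA h fun k _ => hq k) h3

theorem exists_bc_approx {K : ℕ} (hK : 1 ≤ K) (h : ℕ → Fin N → ℂ) {a : ℕ → ℝ} (ha : Antitone a)
    (haK : a K = 0) {W : J → Matrix (Fin N) (Fin N) ℂ} {e : J → ℝ} (hs : IsPowerSystem W e)
    {c : ℝ} (hc : 0 < c)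
    (hweak : ∀ x : J → ℝ, (∀ j, 0 ≤ x j) → (linCov W x).PosDef →
      ∃ p ∈ powerSimplex K, c ≤ macWsr K h a (linCov W x) (fun k => linBudget e x * p k))
    {tol : ℝ} (htol : 0 < tol) :
    ∃ (S : ℕ → Matrix (Fin N) (Fin N) ℂ) (SE : Matrix (Fin N) (Fin N) ℂ),
      (∀ k < K, (S k).PosSemidef) ∧ SE.PosSemidef ∧
      (∀ j, trMul (∑ k ∈ Finset.range K, S k + SE) (W j) ≤ e j + tol) ∧
      c - tol ≤ ∑ i ∈ Finset.range K, a i * bcRate K h S i := by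
  classical
  obtain ⟨δ, hδ, hδle⟩ := exists_le_sum_mul_one_sub_exp K
    (c := fun i => a i - a (i + 1)) (fun i => sub_nonneg.2 (ha (Nat.le_succ i))) (half_pos hc)
  set E := ∑ j, |e j| with hE
  have hE0 : 0 ≤ E := Finset.sum_nonneg fun j _ => abs_nonneg _
  have hEle : ∀ j, e j ≤ E := fun j => (le_abs_self _).trans
    (Finset.single_le_sum (f := fun j => |e j|) (fun i _ => abs_nonneg _) (Finset.mem_univ j))
  set R := N * E with hR
  have hR0 : 0 ≤ R := mul_nonneg N.cast_nonneg hE0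
  -- `ε ≤ c / 2` keeps the value above `c / 2`, the level for which `δ` was chosen; `ε ≤ δ / 4`
  -- gives `P κ ≥ δ / 2`; the last bound absorbs the constraint error into `tol`.
  obtain ⟨ε, hε, hεtol, hεc, hεδ, hεtolδ⟩ : ∃ ε : ℝ, 0 < ε ∧ ε ≤ tol ∧ ε ≤ c / 2 ∧ ε ≤ δ / 4 ∧
      ε * (2 * E + R) ≤ tol * (δ / 2) := by
    have hden : 0 < 2 * E + R + 1 := by linarith
    have h4 : 0 < tol * (δ / 2) / (2 * E + R + 1) := by positivity
    refine ⟨min (min tol (c / 2)) (min (δ / 4) (tol * (δ / 2) / (2 * E + R + 1))), ?_, ?_, ?_, ?_,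
      ?_⟩
    · exact lt_min (lt_min htol (by linarith)) (lt_min (by linarith) h4)
    · exact (min_le_left _ _).trans (min_le_left _ _)
    · exact (min_le_left _ _).trans (min_le_right _ _)
    · exact (min_le_right _ _).trans (min_le_left _ _)
    · have h5 : min (min tol (c / 2)) (min (δ / 4) (tol * (δ / 2) / (2 * E + R + 1))) ≤
        tol * (δ / 2) / (2 * E + R + 1) := (min_le_right _ _).trans (min_le_right _ _)
      refine (mul_le_mul_of_nonneg_right h5 (by linarith)).trans ?_
      rw [div_mul_eq_mul_div, div_le_iff₀ hden]
      exact mul_le_mul_of_nonneg_left (by linarith) (by positivity)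
  obtain ⟨x, p, hp, hx, hA, hmax, hmin⟩ := exists_saddle hK h ha hs hε
  set A := linCov W x with hAdef
  set P := linBudget e x with hPdef
  have hP : 0 < P := linBudget_pos hs hx hA
  set q : ℕ → ℝ := fun k => P * p k with hqdef
  have hq : ∀ k, 0 ≤ q k := fun k => mul_nonneg hP.le (hp.1 k)
  set g : ℕ → ℝ := macGrad K h a A q with hg
  set η := ∑ k ∈ Finset.range K, p k * g k with hη
  have hPη : ∑ k ∈ Finset.range K, q k * g k = P * η := by
    rw [hη, Finset.mul_sum]
    exact Finset.sum_congr rfl fun k _ => by rw [hqdef]; ring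
  have hsq := sum_sq_le_one_of_mem_powerSimplex hp
  have hsq0 : 0 ≤ ∑ k ∈ Finset.range K, p k ^ 2 := Finset.sum_nonneg fun k _ => sq_nonneg _
  -- the value at the saddle point
  have hval : c - ε ≤ macWsr K h a A q := by
    obtain ⟨p₀, hp₀, hcp₀⟩ := hweak x hx hA
    have h1 := hmax p₀ hp₀
    simp only [lagr, ← hAdef, ← hPdef] at h1
    have h2 := mul_le_mul_of_nonneg_left (sum_sq_le_one_of_mem_powerSimplex hp₀) hε.le
    have h3 := mul_nonneg hε.le hsq0
    linarith
  have hδη : δ ≤ P * η := by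
    rw [← hPη]
    refine le_trans (hδle (fun i => logDet (macCov A h q (Finset.range (i + 1))) - logDet A)
      (fun i => ?_) ?_) (sum_one_sub_exp_le_sum_macGrad h ha hA hq)
    · exact sub_nonneg.2 (logDet_mono hA (posDef_macCov hA h fun k _ => hq k)
        (by simpa [macCov] using posSemidef_sum_smul_outer h fun k _ => hq k))
    · have : c / 2 ≤ macWsr K h a A q := by linarith
      exact this
  -- stationarity in the powers
  set m := P * η - 2 * ε * ∑ k ∈ Finset.range K, p k ^ 2 with hm
  have hmsum : ∑ k ∈ Finset.range K, p k * (P * g k - 2 * ε * p k) = m := by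
    rw [hm, hη, Finset.mul_sum, Finset.mul_sum, ← Finset.sum_sub_distrib]
    exact Finset.sum_congr rfl fun k _ => by ring
  have hgle : ∀ l < K, P * g l - 2 * ε * p l ≤ m := by
    intro l hl
    have h1 := sum_mul_sub_macGrad_le ha haK hA hP.le hp hmax (single_mem_powerSimplex hl)
    simp only [sub_mul, Finset.sum_sub_distrib] at h1
    rw [Finset.sum_eq_single l] at h1
    · simp only [Pi.single_eq_same, one_mul] at h1
      have h2 := hmsum
      linarith
    · intro k _ hk; simp [hk]
    · intro hk; exact absurd (Finset.mem_range.2 hl) hk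
  have hgeq : ∀ l < K, 0 < p l → P * g l - 2 * ε * p l = m := by
    intro l hl hpl
    have h1 : ∑ k ∈ Finset.range K, p k * (m - (P * g k - 2 * ε * p k)) = 0 := by
      rw [Finset.sum_congr rfl fun k _ => mul_sub (p k) m _, Finset.sum_sub_distrib, hmsum]
      rw [← Finset.sum_mul, hp.2.2, one_mul, sub_self]
    have h2 := (Finset.sum_eq_zero_iff_of_nonneg fun k hk => mul_nonneg (hp.1 k)
      (sub_nonneg.2 (hgle k (Finset.mem_range.1 hk)))).1 h1 l (Finset.mem_range.2 hl)
    have h3 := (mul_eq_zero.1 h2).resolve_left hpl.ne'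
    linarith
  -- On the support of `p`, `P g = m + 2εp ≥ m`, and `m ≥ P η - 2ε` because `∑ p² ≤ 1`. So `κ`
  -- bounds the gradient below at every active user.
  set κ := η - 2 * ε / P with hκdef
  have hPκ : P * κ = P * η - 2 * ε := by rw [hκdef]; field_simp
  have hPκδ : δ / 2 ≤ P * κ := by linarith
  have hκ : 0 < κ := by
    by_contra hcon
    have := mul_nonpos_of_nonneg_of_nonpos hP.le (not_lt.1 hcon)
    linarith
  have hκg : ∀ i < K, 0 < q i → κ ≤ g i := by
    intro i hi hqi
    have hpi : 0 < p i := pos_of_mul_pos_right hqi hP.le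
    have h1 := hgeq i hi hpi
    have h2 := mul_le_mul_of_nonneg_left hsq (by linarith : 0 ≤ 2 * ε)
    have h3 : 0 ≤ 2 * ε * p i := by positivity
    refine le_of_mul_le_mul_left ?_ hP
    linarith
  -- stationarity in the multipliers
  set Q := a 0 • A⁻¹ - macInv K h a A q with hQ
  have hstat : ∀ (d : J → ℝ) (τ : ℝ), 0 < τ →
      (∀ t ∈ Set.Ico 0 τ, (∀ j, 0 ≤ (x + t • d) j) ∧ (linCov W (x + t • d)).PosDef) →
      trMul (Q + ε • A⁻¹) (linCov W d) ≤ linBudget e d * η + ε * ∑ j, d j := by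
    intro d τ hτ hd
    exact trMul_linCov_le_of_min ha haK hε hp hmax hτ (fun t ht => (hd t ht).2)
      (fun t ht => (linBudget_pos hs (hd t ht).1 (hd t ht).2).le)
      (fun t ht => hmin _ (hd t ⟨ht.1.le, ht.2⟩).1 (hd t ⟨ht.1.le, ht.2⟩).2)
  -- Moving along `-x` shrinks all multipliers. By Euler's identity the terms `P η` cancel, leaving
  -- a bound independent of `ε`.
  have hxsum : ∑ j, x j ≤ N := by
    have hneg : ∀ t : ℝ, x + t • (-x) = (0 : J → ℝ) + (1 - t) • x := by
      intro t; ext j; simp; ring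
    have h1 := hstat (-x) 1 one_pos (fun t ht => by
      rw [hneg, linCov_add_smul]
      refine ⟨fun j => ?_, ?_⟩
      · have := mul_nonneg (sub_nonneg.2 ht.2.le) (hx j)
        simpa using this
      · have h0 : linCov W (0 : J → ℝ) = 0 := by simp [linCov]
        have h2 : (1 - t) • linCov W x = ((1 - t : ℝ) : ℂ) • linCov W x := by ext; simp
        rw [h0, zero_add, h2]
        exact hA.smul (by exact_mod_cast sub_pos.2 ht.2))
    have h2 : linCov W (-x) = (-1 : ℝ) • A := by simp [linCov, hAdef]
    have h3 : linBudget e (-x) = -P := by simp [linBudget, hPdef]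
    have h4 : ∑ j, (-x) j = -∑ j, x j := by simp
    rw [h2, h3, h4, trMul_smul, add_trMul, smul_trMul, trMul_inv_self hA,
      trMul_sub_macInv h haK hA hq, hPη] at h1
    have h5 : ε * ∑ j, x j ≤ ε * N := by linarith
    exact le_of_mul_le_mul_left h5 hε
  have hPR : P ≤ R := by
    have h1 : P ≤ ∑ j, x j * E :=
      Finset.sum_le_sum fun j _ => mul_le_mul_of_nonneg_left (hEle j) (hx j)
    rw [← Finset.sum_mul] at h1
    exact h1.trans (mul_le_mul_of_nonneg_right hxsum hE0)
  -- Raising the single multiplier `j` yields the `j`-th constraint.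
  have hconstr : ∀ j, trMul (Q + ε • A⁻¹) (W j) ≤ e j * η + ε := by
    intro j
    obtain ⟨τ, hτ, hτA⟩ := hs.posDef_add j A hA
    have h1 := hstat (Pi.single j 1) τ hτ (fun t ht => by
      refine ⟨fun i => ?_, ?_⟩
      · have h2 : 0 ≤ (Pi.single j 1 : J → ℝ) i := by
          by_cases hi : i = j
          · subst hi; simp
          · simp [hi]
        exact add_nonneg (hx i) (mul_nonneg ht.1 h2)
      · rw [linCov_add_smul, linCov_single]
        exact hτA t ht)
    rw [linCov_single, linBudget_single] at h1
    simpa using h1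
  have hsumS : ∑ k ∈ Finset.range K, κ⁻¹ • bcCov h a A q k = κ⁻¹ • Q := by
    rw [← Finset.smul_sum, Finset.range_eq_Ico, sum_Ico_bcCov h a A q (Nat.zero_le K), haK,
      zero_smul, sub_zero, ← Finset.range_eq_Ico, Finset.range_zero, macCov_empty]
    rfl
  -- The energy covariance carries the term `ε A⁻¹` produced by the log det barrier.
  refine ⟨fun k => κ⁻¹ • bcCov h a A q k, κ⁻¹ • (ε • A⁻¹), fun k hk => ?_, ?_, fun j => ?_, ?_⟩
  · exact posSemidef_smul (posSemidef_bcCov h (by rw [← haK]; exact ha hk.le) hA hq)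
      (inv_nonneg.2 hκ.le)
  · exact posSemidef_smul (posSemidef_smul hA.inv.posSemidef hε.le) (inv_nonneg.2 hκ.le)
  · rw [hsumS, ← smul_add, smul_trMul, inv_mul_le_iff₀ hκ]
    refine (hconstr j).trans ?_
    refine le_of_mul_le_mul_left ?_ hP
    have h1 := mul_le_mul_of_nonneg_left hPκδ htol.le
    have h2 := mul_le_mul_of_nonneg_left hPR hε.le
    have h3 := mul_le_mul_of_nonneg_left (hEle j) hε.le
    have h4 : P * (κ * (e j + tol)) = e j * (P * η) - 2 * (ε * e j) + tol * (P * κ) := by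
      linear_combination e j * hPκ
    rw [h4]
    linarith
  · have h1 := macWsr_le_sum_bcRate h ha haK hA hq hκ hκg
    linarith

/-! ### Compactness -/

lemma norm_apply_le_trace {A : Matrix (Fin N) (Fin N) ℂ} (hA : A.PosSemidef) (i j : Fin N) :
    ‖A i j‖ ≤ 2 * A.trace.re := by
  obtain ⟨C, rfl⟩ := exists_eq_conjTranspose_mul_self hA
  have hdiag : ∀ l, ((Cᴴ * C) l l).re = ∑ k, ‖C k l‖ ^ 2 := by
    intro l
    simp only [Matrix.mul_apply, Matrix.conjTranspose_apply, Complex.re_sum]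
    refine Finset.sum_congr rfl fun k _ => ?_
    rw [Complex.star_def, ← Complex.normSq_eq_conj_mul_self, Complex.ofReal_re,
      Complex.normSq_eq_norm_sq]
  have htr : (Cᴴ * C).trace.re = ∑ l, ∑ k, ‖C k l‖ ^ 2 := by
    rw [Matrix.trace, Complex.re_sum]
    exact Finset.sum_congr rfl fun l _ => hdiag l
  have hle : ∀ l, ∑ k, ‖C k l‖ ^ 2 ≤ (Cᴴ * C).trace.re := fun l => by
    rw [htr]
    exact Finset.single_le_sum (f := fun l => ∑ k, ‖C k l‖ ^ 2)
      (fun _ _ => Finset.sum_nonneg fun _ _ => sq_nonneg _) (Finset.mem_univ l)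
  have h1 : ‖(Cᴴ * C) i j‖ ≤ ∑ k, (‖C k i‖ ^ 2 + ‖C k j‖ ^ 2) := by
    rw [Matrix.mul_apply]
    refine (norm_sum_le _ _).trans (Finset.sum_le_sum fun k _ => ?_)
    rw [Matrix.conjTranspose_apply, norm_mul, norm_star]
    nlinarith [sq_nonneg (‖C k i‖ - ‖C k j‖), sq_nonneg ‖C k i‖, sq_nonneg ‖C k j‖]
  rw [Finset.sum_add_distrib] at h1
  linarith [hle i, hle j]

lemma isCompact_posSemidef_trace_le (R : ℝ) :
    IsCompact {A : Matrix (Fin N) (Fin N) ℂ | A.PosSemidef ∧ A.trace.re ≤ R} := by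
  have hc : IsCompact (Set.univ.pi fun _ : Fin N => Set.univ.pi fun _ : Fin N =>
      Metric.closedBall (0 : ℂ) (2 * R)) :=
    isCompact_univ_pi fun _ => isCompact_univ_pi fun _ => isCompact_closedBall _ _
  refine IsCompact.of_isClosed_subset (X := Matrix (Fin N) (Fin N) ℂ) hc ?_ ?_
  · have ht : Continuous fun A : Matrix (Fin N) (Fin N) ℂ => A.trace.re := by fun_prop
    exact isClosed_posSemidef.inter (isClosed_le ht continuous_const)
  · intro A hA i _ j _
    have h1 := norm_apply_le_trace hA.1 i j
    have h2 := hA.2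
    simp only [Metric.mem_closedBall, dist_zero_right]
    linarith

lemma bcRate_congr {K : ℕ} (h : ℕ → Fin N → ℂ) {S S' : ℕ → Matrix (Fin N) (Fin N) ℂ}
    (hS : ∀ k < K, S k = S' k) (i : ℕ) : bcRate K h S i = bcRate K h S' i := by
  have h1 : ∀ m, ∑ k ∈ Finset.Ico m K, S k = ∑ k ∈ Finset.Ico m K, S' k := fun m =>
    Finset.sum_congr rfl fun k hk => hS k (Finset.mem_Ico.1 hk).2
  rw [bcRate, bcRate, h1, h1]

lemma continuousOn_bcRate (K : ℕ) (h : ℕ → Fin N → ℂ) (i : ℕ) :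
    ContinuousOn (fun S : ℕ → Matrix (Fin N) (Fin N) ℂ => bcRate K h S i)
      {S | ∀ k, (S k).PosSemidef} := by
  have hc : ∀ m, Continuous fun S : ℕ → Matrix (Fin N) (Fin N) ℂ =>
      1 + quad (∑ k ∈ Finset.Ico m K, S k) (h i) := fun m =>
    continuous_const.add ((continuous_quad (h i)).comp (by fun_prop))
  have hpos : ∀ m, ∀ S ∈ {S : ℕ → Matrix (Fin N) (Fin N) ℂ | ∀ k, (S k).PosSemidef},
      1 + quad (∑ k ∈ Finset.Ico m K, S k) (h i) ≠ 0 := fun m S hS => by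
    have := quad_nonneg (Matrix.posSemidef_sum (Finset.Ico m K) fun k _ => hS k) (h i)
    linarith
  unfold bcRate
  exact ((hc i).continuousOn.div (hc (i + 1)).continuousOn (hpos _)).log
    fun S hS => div_ne_zero (hpos _ S hS) (hpos _ S hS)

/-- The constraint with `W j = 1` bounds all traces, so approximate points for tolerances `1 / (n +
1)` have a convergent subsequence, along which the constraints and rates pass to the limit. -/
theorem exists_bc_of_approx {K : ℕ} (h : ℕ → Fin N → ℂ) (a : ℕ → ℝ)
    {ι : Type*} {W : ι → Matrix (Fin N) (Fin N) ℂ} {e : ι → ℝ} (hone : ∃ j, W j = 1) {c : ℝ}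
    (happrox : ∀ tol : ℝ, 0 < tol →
      ∃ (S : ℕ → Matrix (Fin N) (Fin N) ℂ) (SE : Matrix (Fin N) (Fin N) ℂ),
      (∀ k < K, (S k).PosSemidef) ∧ SE.PosSemidef ∧
      (∀ j, trMul (∑ k ∈ Finset.range K, S k + SE) (W j) ≤ e j + tol) ∧
      c - tol ≤ ∑ i ∈ Finset.range K, a i * bcRate K h S i) :
    ∃ (S : ℕ → Matrix (Fin N) (Fin N) ℂ) (SE : Matrix (Fin N) (Fin N) ℂ),
      (∀ k, (S k).PosSemidef) ∧ SE.PosSemidef ∧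
      (∀ j, trMul (∑ k ∈ Finset.range K, S k + SE) (W j) ≤ e j) ∧
      c ≤ ∑ i ∈ Finset.range K, a i * bcRate K h S i := by
  obtain ⟨j₀, hj₀⟩ := hone
  set tol : ℕ → ℝ := fun n => 1 / ((n : ℝ) + 1) with htol
  have htol0 : ∀ n, 0 < tol n := fun n => Nat.one_div_pos_of_nat
  have htol1 : ∀ n, tol n ≤ 1 := fun n => by
    have hn : (0 : ℝ) ≤ n := n.cast_nonneg
    exact (div_le_one (by linarith)).2 (by linarith)
  have htollim : Filter.Tendsto tol Filter.atTop (nhds 0) := tendsto_one_div_add_atTop_nhds_zero_nat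
  choose S' SE hS' hSE hcon' hval' using fun n => happrox (tol n) (htol0 n)
  -- Nothing is known about the covariances from index `K` on; zeroing them puts the whole sequence
  -- in a compact product.
  set S : ℕ → ℕ → Matrix (Fin N) (Fin N) ℂ := fun n k => if k < K then S' n k else 0 with hSdef
  have hSS' : ∀ n, ∀ k < K, S' n k = S n k := fun n k hk => by simp [hSdef, hk]
  have hS : ∀ n k, (S n k).PosSemidef := by
    intro n k
    by_cases hk : k < K
    · rw [← hSS' n k hk]; exact hS' n k hk
    · simpa [hSdef, hk] using Matrix.PosSemidef.zero
  have hsum : ∀ n, ∑ k ∈ Finset.range K, S' n k = ∑ k ∈ Finset.range K, S n k := fun n =>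
    Finset.sum_congr rfl fun k hk => hSS' n k (Finset.mem_range.1 hk)
  have hcon : ∀ n j, trMul (∑ k ∈ Finset.range K, S n k + SE n) (W j) ≤ e j + tol n :=
    fun n j => by rw [← hsum]; exact hcon' n j
  have hval : ∀ n, c - tol n ≤ ∑ i ∈ Finset.range K, a i * bcRate K h (S n) i := fun n => by
    refine (hval' n).trans (le_of_eq (Finset.sum_congr rfl fun i _ => ?_))
    rw [bcRate_congr h (hSS' n)]
  have htrS : ∀ n k, 0 ≤ (S n k).trace.re := fun n k => (Complex.le_def.1 (hS n k).trace_nonneg).1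
  have htrE : ∀ n, 0 ≤ (SE n).trace.re := fun n => (Complex.le_def.1 (hSE n).trace_nonneg).1
  have htr : ∀ n, ∑ k ∈ Finset.range K, (S n k).trace.re + (SE n).trace.re ≤ e j₀ + 1 := by
    intro n
    have h1 := hcon n j₀
    rw [hj₀, add_trMul, sum_trMul] at h1
    simp only [trMul_one] at h1
    linarith [htol1 n]
  have hmem : ∀ n, (S n, SE n) ∈ (Set.univ.pi fun _ : ℕ =>
      {A : Matrix (Fin N) (Fin N) ℂ | A.PosSemidef ∧ A.trace.re ≤ e j₀ + 1}) ×ˢ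
      {A : Matrix (Fin N) (Fin N) ℂ | A.PosSemidef ∧ A.trace.re ≤ e j₀ + 1} := by
    intro n
    have h0 : 0 ≤ ∑ k ∈ Finset.range K, (S n k).trace.re :=
      Finset.sum_nonneg fun k _ => htrS n k
    refine ⟨fun k _ => ⟨hS n k, ?_⟩, hSE n, by linarith [htr n]⟩
    by_cases hk : k < K
    · have h1 := Finset.single_le_sum (f := fun k => (S n k).trace.re) (fun k _ => htrS n k)
        (Finset.mem_range.2 hk)
      linarith [htr n, htrE n]
    · have h1 : (S n k).trace.re = 0 := by simp [hSdef, hk]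
      linarith [htr n, htrE n]
  have : FirstCountableTopology (Matrix (Fin N) (Fin N) ℂ) :=
    inferInstanceAs (FirstCountableTopology (Fin N → Fin N → ℂ))
  obtain ⟨⟨T, TE⟩, hT, φ, hφ, hlim⟩ := ((isCompact_univ_pi fun _ =>
    isCompact_posSemidef_trace_le _).prod (isCompact_posSemidef_trace_le _)).tendsto_subseq hmem
  have hTpos : ∀ k, (T k).PosSemidef := fun k => (hT.1 k trivial).1
  have hlim1 : Filter.Tendsto (fun n => S (φ n)) Filter.atTop (nhds T) :=
    (continuous_fst.tendsto _).comp hlim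
  have htolφ : Filter.Tendsto (fun n => tol (φ n)) Filter.atTop (nhds 0) :=
    htollim.comp hφ.tendsto_atTop
  refine ⟨T, TE, hTpos, hT.2.1, fun j => ?_, ?_⟩
  · have hc : Continuous fun z : (ℕ → Matrix (Fin N) (Fin N) ℂ) × Matrix (Fin N) (Fin N) ℂ =>
        trMul (∑ k ∈ Finset.range K, z.1 k + z.2) (W j) :=
      (continuous_trMul_left (W j)).comp (by fun_prop)
    have h1 := (hc.tendsto (T, TE)).comp hlim
    have h2 : Filter.Tendsto (fun n => e j + tol (φ n)) Filter.atTop (nhds (e j + 0)) :=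
      tendsto_const_nhds.add htolφ
    rw [add_zero] at h2
    exact le_of_tendsto_of_tendsto' h1 h2 fun n => hcon (φ n) j
  · have hc : ContinuousOn (fun S : ℕ → Matrix (Fin N) (Fin N) ℂ =>
        ∑ i ∈ Finset.range K, a i * bcRate K h S i) {S | ∀ k, (S k).PosSemidef} :=
      continuousOn_finsetSum _ fun i _ => continuousOn_const.mul (continuousOn_bcRate K h i)
    have h1 := (hc T hTpos).tendsto.comp
      (tendsto_nhdsWithin_iff.2 ⟨hlim1, Filter.Eventually.of_forall fun n => hS (φ n)⟩)
    have h2 : Filter.Tendsto (fun n => c - tol (φ n)) Filter.atTop (nhds (c - 0)) :=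
      tendsto_const_nhds.sub htolφ
    rw [sub_zero] at h2
    exact le_of_tendsto_of_tendsto' h2 h1 fun n => hval (φ n)

/-! ### Enumerations of the users -/

/-- The extension by zero of a family indexed by `Fin K`. -/
def finExtend {K : ℕ} {β : Type*} [Zero β] (f : Fin K → β) (k : ℕ) : β :=
  if hk : k < K then f ⟨k, hk⟩ else 0

@[simp] lemma finExtend_val {K : ℕ} {β : Type*} [Zero β] (f : Fin K → β) (i : Fin K) :
    finExtend f i = f i := by
  simp [finExtend]

lemma finExtend_of_le {K : ℕ} {β : Type*} [Zero β] (f : Fin K → β) {k : ℕ} (hk : K ≤ k) :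
    finExtend f k = 0 := by
  simp [finExtend, not_lt.2 hk]

lemma finExtend_nonneg {K : ℕ} {f : Fin K → ℝ} (hf : ∀ i, 0 ≤ f i) (k : ℕ) :
    0 ≤ finExtend f k := by
  unfold finExtend
  split_ifs
  · exact hf _
  · exact le_rfl

lemma bcRate_eq_dpcRate (M : SwiptBC N KI KE) (hσ : 0 < M.σ)
    (S : Fin KI → Matrix (Fin N) (Fin N) ℂ) (hS : ∀ i, (S i).PosSemidef)
    (π : Equiv.Perm (Fin KI)) {h : ℕ → Fin N → ℂ} {T : ℕ → Matrix (Fin N) (Fin N) ℂ}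
    (hh : ∀ i : Fin KI, h i = ((M.σ⁻¹ : ℝ) : ℂ) • M.h (π i)) (hT : ∀ i : Fin KI, T i = S (π i))
    (i : Fin KI) : bcRate KI h T i = Real.log 2 * M.dpcRate S π i := by
  have hquad : ∀ B : Matrix (Fin N) (Fin N) ℂ, quad B (h i) = (M.σ ^ 2)⁻¹ * quad B (M.h (π i)) := by
    intro B
    rw [hh, quad, quad, Matrix.mulVec_smul, star_smul, smul_dotProduct, dotProduct_smul, smul_smul,
      Complex.star_def, Complex.conj_ofReal, ← Complex.ofReal_mul, smul_eq_mul,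
      Complex.re_ofReal_mul]
    congr 1
    rw [pow_two, mul_inv]
  have h1 : ∑ k ∈ Finset.Ico (i : ℕ) KI, T k = ∑ k ∈ Finset.Ici i, S (π k) := by
    rw [← Fin.map_valEmbedding_Ici, Finset.sum_map]
    exact Finset.sum_congr rfl fun k _ => hT k
  have h2 : ∑ k ∈ Finset.Ico ((i : ℕ) + 1) KI, T k = ∑ k ∈ Finset.Ioi i, S (π k) := by
    have : Finset.Ico ((i : ℕ) + 1) KI = Finset.Ioo (i : ℕ) KI := by
      ext k; simp only [Finset.mem_Ico, Finset.mem_Ioo]; omega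
    rw [this, ← Fin.map_valEmbedding_Ioi, Finset.sum_map]
    exact Finset.sum_congr rfl fun k _ => hT k
  have hlog2 : Real.log 2 ≠ 0 := (Real.log_pos one_lt_two).ne'
  rw [bcRate, h1, h2, hquad, hquad, dpcRate, Real.logb, mul_div_cancel₀ _ hlog2]
  congr 1
  have hσ2 : 0 < M.σ ^ 2 := by positivity
  have h3 := quad_nonneg (Matrix.posSemidef_sum (Finset.Ioi i) fun k _ => hS (π k)) (M.h (π i))
  have h4 : M.σ ^ 2 + quad (∑ k ∈ Finset.Ioi i, S (π k)) (M.h (π i)) ≠ 0 := by linarith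
  field_simp

lemma dpcRate_nonneg (M : SwiptBC N KI KE) (hσ : 0 < M.σ)
    {S : Fin KI → Matrix (Fin N) (Fin N) ℂ} (hS : ∀ i, (S i).PosSemidef)
    (π : Equiv.Perm (Fin KI)) (i : Fin KI) : 0 ≤ M.dpcRate S π i := by
  have hσ2 : 0 < M.σ ^ 2 := by positivity
  have h1 := quad_nonneg (Matrix.posSemidef_sum (Finset.Ioi i) fun k _ => hS (π k)) (M.h (π i))
  have h2 := quad_nonneg (hS (π i)) (M.h (π i))
  refine Real.logb_nonneg one_lt_two ?_
  rw [one_le_div (by linarith), ← Finset.Ioi_insert, Finset.sum_insert (by simp)]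
  have h3 : quad (S (π i) + ∑ k ∈ Finset.Ioi i, S (π k)) (M.h (π i)) =
      quad (S (π i)) (M.h (π i)) + quad (∑ k ∈ Finset.Ioi i, S (π k)) (M.h (π i)) := by
    simp only [← trMul_outer, add_trMul]
  linarith

/-- Every broadcast point with an arbitrary encoding order is matched by the powers of a dual
multiple access channel. -/
lemma exists_mac_powers_perm (M : SwiptBC N KI KE) (hσ : 0 < M.σ)
    {S : Fin KI → Matrix (Fin N) (Fin N) ℂ} (hS : ∀ i, (S i).PosSemidef)
    (π : Equiv.Perm (Fin KI)) {A : Matrix (Fin N) (Fin N) ℂ} (hA : A.PosDef) :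
    ∃ q : Fin KI → ℝ, (∀ u, 0 ≤ q u) ∧ ∑ u, q u ≤ ∑ u, trMul A (S u) ∧
      ∀ U : Finset (Fin KI), ∑ u ∈ U, Real.log 2 * M.dpcRate S π (π.symm u) ≤
        logDet (A + ∑ u ∈ U, q u • outer (((M.σ⁻¹ : ℝ) : ℂ) • M.h u)) - logDet A := by
  set h : ℕ → Fin N → ℂ := finExtend fun i => ((M.σ⁻¹ : ℝ) : ℂ) • M.h (π i) with hh
  set T : ℕ → Matrix (Fin N) (Fin N) ℂ := finExtend fun i => S (π i) with hT
  have hTpos : ∀ k, (T k).PosSemidef := by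
    intro k
    by_cases hk : k < KI
    · have := finExtend_val (fun i => S (π i)) ⟨k, hk⟩
      simp only at this
      rw [hT, this]; exact hS _
    · rw [hT, finExtend_of_le _ (not_lt.1 hk)]; exact Matrix.PosSemidef.zero
  obtain ⟨q, hq, hsum, hU⟩ := exists_mac_powers hA KI h hTpos
  refine ⟨fun u => q (π.symm u), fun u => hq _, ?_, fun U => ?_⟩
  · have h1 : ∑ u, q (π.symm u) = ∑ k ∈ Finset.range KI, q k := by
      rw [Finset.sum_range, ← Equiv.sum_comp π.symm fun i : Fin KI => q i]
    have h2 : ∑ u, trMul A (S u) = ∑ k ∈ Finset.range KI, trMul A (T k) := by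
      rw [Finset.sum_range, ← Equiv.sum_comp π]
      simp [hT]
    rw [h1, h2]
    exact hsum
  · have h1 := hU (U.map (π.symm.toEmbedding.trans Fin.valEmbedding)) (by
      intro k hk
      obtain ⟨u, -, rfl⟩ := Finset.mem_map.1 hk
      exact Finset.mem_range.2 (π.symm u).2)
    rw [Finset.sum_map, macCov, Finset.sum_map] at h1
    have h2 : ∀ u, bcRate KI h T ((π.symm.toEmbedding.trans Fin.valEmbedding) u) =
        Real.log 2 * M.dpcRate S π (π.symm u) := fun u =>
      bcRate_eq_dpcRate M hσ S hS π (fun i => finExtend_val _ i) (fun i => finExtend_val _ i) _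
    have h3 : ∀ u, h ((π.symm.toEmbedding.trans Fin.valEmbedding) u) =
        ((M.σ⁻¹ : ℝ) : ℂ) • M.h u := fun u => by
      have := finExtend_val (fun i => ((M.σ⁻¹ : ℝ) : ℂ) • M.h (π i)) (π.symm u)
      rw [Equiv.apply_symm_apply] at this
      exact this
    simp only [h2, h3] at h1
    exact h1

/-- A permutation that sorts the users by decreasing rate weight. -/
def sortPerm (M : SwiptBC N KI KE) : Equiv.Perm (Fin KI) := Tuple.sort fun i => -M.α i

/-- The sorted rate weights, rescaled from bits to nats. -/
def sortedWeight (M : SwiptBC N KI KE) : ℕ → ℝ :=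
  finExtend fun i => M.α (M.sortPerm i) / Real.log 2

/-- The sorted channel vectors, normalised to unit noise. -/
def sortedChannel (M : SwiptBC N KI KE) : ℕ → Fin N → ℂ :=
  finExtend fun i => ((M.σ⁻¹ : ℝ) : ℂ) • M.h (M.sortPerm i)

lemma antitone_sortedWeight (M : SwiptBC N KI KE) (hα : ∀ i, 0 < M.α i) :
    Antitone M.sortedWeight := by
  have hlog2 : 0 < Real.log 2 := Real.log_pos one_lt_two
  intro i j hij
  by_cases hj : j < KI
  · have hi : i < KI := hij.trans_lt hj
    have h1 := Tuple.monotone_sort (fun i => -M.α i) (show (⟨i, hi⟩ : Fin KI) ≤ ⟨j, hj⟩ from hij)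
    simp only [sortedWeight, finExtend, hi, hj, dif_pos]
    refine div_le_div_of_nonneg_right ?_ hlog2.le
    simpa [sortPerm] using h1
  · rw [sortedWeight, finExtend_of_le _ (not_lt.1 hj)]
    exact finExtend_nonneg (fun i => div_nonneg (hα _).le hlog2.le) i

lemma sortedWeight_card (M : SwiptBC N KI KE) : M.sortedWeight KI = 0 :=
  finExtend_of_le _ le_rfl

lemma sum_range_succ_eq_sum_map {β : Type*} [AddCommMonoid β] {K : ℕ} (τ : Equiv.Perm (Fin K))
    {f : ℕ → β} {f' : Fin K → β} (hf : ∀ i : Fin K, f i = f' (τ i)) {j : ℕ} (hj : j < K) :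
    ∑ k ∈ Finset.range (j + 1), f k =
      ∑ u ∈ (Finset.Iic (⟨j, hj⟩ : Fin K)).map τ.toEmbedding, f' u := by
  have h1 : Finset.range (j + 1) = (Finset.Iic (⟨j, hj⟩ : Fin K)).map Fin.valEmbedding := by
    rw [Fin.map_valEmbedding_Iic]
    ext k
    simp only [Finset.mem_range, Finset.mem_Iic]
    omega
  rw [h1, Finset.sum_map, Finset.sum_map]
  exact Finset.sum_congr rfl fun i _ => hf i

lemma macWsr_mono {K : ℕ} (h : ℕ → Fin N → ℂ) {a : ℕ → ℝ} (ha : Antitone a)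
    {A : Matrix (Fin N) (Fin N) ℂ} (hA : A.PosDef) {q q' : ℕ → ℝ} (hq : ∀ k, 0 ≤ q k)
    (hqq' : ∀ k, q k ≤ q' k) : macWsr K h a A q ≤ macWsr K h a A q' := by
  refine Finset.sum_le_sum fun i _ =>
    mul_le_mul_of_nonneg_left ?_ (sub_nonneg.2 (ha (Nat.le_succ i)))
  refine sub_le_sub_right (logDet_mono (posDef_macCov hA h fun k _ => hq k)
    (posDef_macCov hA h fun k _ => (hq k).trans (hqq' k)) ?_) _
  have h1 : macCov A h q' (Finset.range (i + 1)) - macCov A h q (Finset.range (i + 1)) =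
      ∑ k ∈ Finset.range (i + 1), (q' k - q k) • outer (h k) := by
    simp only [macCov, sub_smul, Finset.sum_sub_distrib]
    abel
  rw [h1]
  exact posSemidef_sum_smul_outer h fun k _ => sub_nonneg.2 (hqq' k)

/-- The weighted sum-rate of an admissible point is at most that of the dual multiple access
channel with the sorted decoding order, for a suitable use of the budget. -/
lemma exists_powerSimplex_wsr_le (M : SwiptBC N KI KE) (hKI : 1 ≤ KI) (hσ : 0 < M.σ)
    (hα : ∀ i, 0 < M.α i) {x : Point N KI} (hx : M.Admissible x)
    {A : Matrix (Fin N) (Fin N) ℂ} (hA : A.PosDef) {P : ℝ} (hP : 0 < P)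
    (hbudget : ∑ i, trMul A (x.S i) + trMul A x.SE ≤ P) :
    ∃ p ∈ powerSimplex KI,
      M.wsr x.r ≤ macWsr KI M.sortedChannel M.sortedWeight A (fun k => P * p k) := by
  obtain ⟨hr, hSE, hS⟩ := hx
  obtain ⟨π, -, hπ⟩ := Set.mem_iUnion.1 hr
  obtain ⟨q, hq, hqsum, hqU⟩ := exists_mac_powers_perm M hσ hS π hA
  have hlog2 : 0 < Real.log 2 := Real.log_pos one_lt_two
  set τ := M.sortPerm with hτ
  set qs : ℕ → ℝ := finExtend fun i => q (τ i) with hqs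
  have hqs0 : ∀ k, 0 ≤ qs k := finExtend_nonneg fun i => hq _
  set ρ : ℕ → ℝ := finExtend fun i => Real.log 2 * M.dpcRate x.S π (π.symm (τ i)) with hρ
  have hqsval : ∀ i : Fin KI, qs i = q (τ i) := fun i => finExtend_val _ i
  have hρval : ∀ i : Fin KI, ρ i = Real.log 2 * M.dpcRate x.S π (π.symm (τ i)) := fun i =>
    finExtend_val (fun i => Real.log 2 * M.dpcRate x.S π (π.symm (τ i))) i
  have hwsr : M.wsr x.r ≤ macWsr KI M.sortedChannel M.sortedWeight A qs := by
    have h1 : M.wsr x.r ≤ ∑ u, M.α u * M.dpcRate x.S π (π.symm u) := by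
      refine Finset.sum_le_sum fun u _ => mul_le_mul_of_nonneg_left ?_ (hα u).le
      have := hπ (π.symm u)
      rwa [Equiv.apply_symm_apply] at this
    have h2 : ∑ u, M.α u * M.dpcRate x.S π (π.symm u) =
        ∑ i ∈ Finset.range KI, M.sortedWeight i * ρ i := by
      rw [Finset.sum_range, ← Equiv.sum_comp τ]
      refine Finset.sum_congr rfl fun i _ => ?_
      rw [hρval, sortedWeight, finExtend_val, ← hτ]
      field_simp
    -- Sorting makes the coefficients after summation by parts nonnegative. Only sums over sets of
    -- top-weighted users remain, and the polymatroid bounds them whatever the order `π`.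
    rw [h2, sum_range_mul_eq_by_parts, sortedWeight_card, zero_mul, add_zero] at h1
    refine h1.trans (Finset.sum_le_sum fun i hi => mul_le_mul_of_nonneg_left ?_
      (sub_nonneg.2 (antitone_sortedWeight M hα (Nat.le_succ i))))
    have hiK := Finset.mem_range.1 hi
    have h3 := hqU ((Finset.Iic (⟨i, hiK⟩ : Fin KI)).map τ.toEmbedding)
    rw [← sum_range_succ_eq_sum_map τ hρval hiK,
      ← sum_range_succ_eq_sum_map τ (f := fun k => qs k • outer (M.sortedChannel k))
        (fun i => by simp only [hqsval, sortedChannel, finExtend_val, hτ]) hiK] at h3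
    exact h3
  have hqP : ∑ k ∈ Finset.range KI, qs k ≤ P := by
    have h1 : ∑ k ∈ Finset.range KI, qs k = ∑ u, q u := by
      rw [Finset.sum_range, ← Equiv.sum_comp τ q]
      exact Finset.sum_congr rfl fun i _ => hqsval i
    have h2 := trMul_nonneg hA.posSemidef hSE
    linarith
  -- The unused share of the budget goes to user 0, which cannot lower `macWsr`.
  set rest := 1 - P⁻¹ * ∑ k ∈ Finset.range KI, qs k with hrest
  have hrest0 : 0 ≤ rest := by
    rw [hrest, sub_nonneg, inv_mul_le_iff₀ hP]
    linarith
  have hsingle : (Pi.single 0 1 : ℕ → ℝ) ∈ powerSimplex KI := single_mem_powerSimplex hKI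
  refine ⟨fun k => P⁻¹ * qs k + rest * (Pi.single 0 1 : ℕ → ℝ) k, ⟨fun k => ?_, fun k hk => ?_, ?_⟩,
    hwsr.trans (macWsr_mono _ (antitone_sortedWeight M hα) hA hqs0 fun k => ?_)⟩
  · exact add_nonneg (mul_nonneg (inv_nonneg.2 hP.le) (hqs0 k)) (mul_nonneg hrest0 (hsingle.1 k))
  · simp only [hsingle.2.1 k hk, hqs, finExtend_of_le _ hk, mul_zero, add_zero]
  · rw [Finset.sum_add_distrib, ← Finset.mul_sum, ← Finset.mul_sum, hsingle.2.2, hrest]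
    ring
  · have h1 := mul_nonneg hP.le (mul_nonneg hrest0 (hsingle.1 k))
    rw [mul_add, mul_inv_cancel_left₀ hP.ne']
    linarith

/-! ### The power constraints of the original problem -/

/-- The matrices of the linear constraints: the total power and the negated harvested powers. -/
def constrMatrix (M : SwiptBC N KI KE) : Option (Fin KE) → Matrix (Fin N) (Fin N) ℂ
  | none => 1
  | some j => -M.G j

/-- The right-hand sides of the linear constraints. -/
def constrBound (M : SwiptBC N KI KE) : Option (Fin KE) → ℝ
  | none => M.Psum
  | some j => -M.E j

lemma linCov_constrMatrix (M : SwiptBC N KI KE) (x : Option (Fin KE) → ℝ) :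
    linCov M.constrMatrix x = M.combA (x none) fun j => x (some j) := by
  rw [linCov, Fintype.sum_option, combA, sub_eq_add_neg, ← Finset.sum_neg_distrib]
  congr 1
  ext
  simp [constrMatrix]

lemma linBudget_constrBound (M : SwiptBC N KI KE) (x : Option (Fin KE) → ℝ) :
    linBudget M.constrBound x = M.combP (x none) fun j => x (some j) := by
  rw [linBudget, Fintype.sum_option, combP, sub_eq_add_neg, ← Finset.sum_neg_distrib]
  simp [constrBound]

lemma trMul_constr_le_iff (M : SwiptBC N KI KE) (Q : Matrix (Fin N) (Fin N) ℂ) :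
    (∀ j, trMul Q (M.constrMatrix j) ≤ M.constrBound j) ↔
      (∀ j, M.E j ≤ trMul Q (M.G j)) ∧ Q.trace.re ≤ M.Psum := by
  have hneg : ∀ j, trMul Q (-M.G j) = -trMul Q (M.G j) := fun j => by simp [trMul]
  rw [Option.forall]
  simp only [constrMatrix, constrBound, trMul_one, hneg, neg_le_neg_iff]
  exact and_comm

/-- With `x = vᴴ A⁻¹ v` one has `v vᴴ ≤ x A`, and `A - t v vᴴ = (1 - t x) A + t (x A - v vᴴ)`. -/
lemma exists_posDef_sub_smul_outer {A : Matrix (Fin N) (Fin N) ℂ} (hA : A.PosDef)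
    (v : Fin N → ℂ) : ∃ τ : ℝ, 0 < τ ∧ ∀ t ∈ Set.Ico 0 τ, (A + t • -outer v).PosDef := by
  have hx := quad_nonneg hA.inv.posSemidef v
  set x := quad A⁻¹ v with hxdef
  have hpsd : (x • A - outer v).PosSemidef := by
    refine posSemidef_of_quad ?_ fun u => ?_
    · refine Matrix.IsHermitian.sub ?_ (posSemidef_outer v).isHermitian
      exact (posSemidef_smul hA.posSemidef hx).isHermitian
    · have h1 := quad_le_quad_inv_mul_trMul hA (posSemidef_outer u) v
      rw [trMul_outer, ← trMul_outer, trMul_comm, trMul_outer] at h1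
      rw [quad_sub, quad_smul]
      linarith
  refine ⟨(x + 1)⁻¹, by positivity, fun t ht => ?_⟩
  have h1 : t * x < 1 := by
    have h2 := mul_lt_mul_of_pos_right ht.2 (by linarith : 0 < x + 1)
    rw [inv_mul_cancel₀ (by linarith)] at h2
    nlinarith [ht.1]
  have h3 : A + t • -outer v = ((1 - t * x : ℝ) : ℂ) • A + t • (x • A - outer v) := by
    have h4 : ((1 - t * x : ℝ) : ℂ) • A = (1 - t * x) • A := by ext; simp
    rw [h4]
    module
  rw [h3]
  exact (hA.smul (by exact_mod_cast sub_pos.2 h1)).add_posSemidef (posSemidef_smul hpsd ht.1)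

lemma isPowerSystem_constr (M : SwiptBC N KI KE) (hKE : 1 ≤ KE) (hE : ∀ j, 0 < M.E j)
    (hfeas : ∃ x : Point N KI, M.FeasibleP1 x) :
    IsPowerSystem M.constrMatrix M.constrBound where
  exists_one := ⟨none, rfl⟩
  posDef_add j A hA := by
    cases j with
    | none =>
      exact ⟨1, one_pos, fun t ht =>
        hA.add_posSemidef (posSemidef_smul Matrix.PosSemidef.one ht.1)⟩
    | some j => exact exists_posDef_sub_smul_outer hA (M.g j)
  feasible := by
    obtain ⟨x, ⟨-, hSE, hS⟩, hharv, hpow⟩ := hfeas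
    refine ⟨(∑ i, x.S i) + x.SE, (trMul_constr_le_iff M _).2 ⟨hharv, hpow⟩, fun A hA => ?_⟩
    have hQ : ((∑ i, x.S i) + x.SE).PosSemidef :=
      (Matrix.posSemidef_sum _ fun i _ => hS i).add hSE
    -- Receiver 0 harvests positive power, and that power is at most `(gᴴ A⁻¹ g) Tr(Q A)`; hence
    -- `Tr(Q A) > 0`.
    have h1 := (hE ⟨0, hKE⟩).trans_le (hharv ⟨0, hKE⟩)
    have h2 := quad_le_quad_inv_mul_trMul hA hQ (M.g ⟨0, hKE⟩)
    rw [← trMul_outer ((∑ i, x.S i) + x.SE), trMul_comm A] at h2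
    have h3 : 0 < quad A⁻¹ (M.g ⟨0, hKE⟩) * trMul ((∑ i, x.S i) + x.SE) A := h1.trans_le h2
    exact pos_of_mul_pos_right h3 (quad_nonneg hA.inv.posSemidef _)

/-! ### Strong duality -/

lemma optP1_le_optP2 (M : SwiptBC N KI KE) : M.optP1 ≤ M.optP2 := by
  refine le_sInf ?_
  rintro _ ⟨l0, l, hl0, hl, rfl⟩
  refine sSup_le ?_
  rintro _ ⟨x, ⟨hadm, hharv, hpow⟩, rfl⟩
  refine le_sSup ⟨x, ⟨hadm, ?_⟩, rfl⟩
  set y : Option (Fin KE) → ℝ := fun j => j.elim l0 l with hy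
  have hy0 : ∀ j, 0 ≤ y j := fun j => by
    cases j with
    | none => exact hl0
    | some j => exact hl j
  have h1 : M.combA l0 l = linCov M.constrMatrix y := (linCov_constrMatrix M y).symm
  have h2 : M.combP l0 l = linBudget M.constrBound y := (linBudget_constrBound M y).symm
  rw [h1, h2, ← trMul_sum, ← trMul_add, trMul_comm, trMul_linCov]
  exact Finset.sum_le_sum fun j _ => mul_le_mul_of_nonneg_left
    ((trMul_constr_le_iff M _).2 ⟨hharv, hpow⟩ j) (hy0 j)

lemma wsr_nonneg (M : SwiptBC N KI KE) (hα : ∀ i, 0 < M.α i) {x : Point N KI}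
    (hx : M.Admissible x) : 0 ≤ M.wsr x.r := by
  obtain ⟨π, hr, -⟩ := Set.mem_iUnion.1 hx.1
  exact Finset.sum_nonneg fun i _ => mul_nonneg (hα i).le (hr i)

lemma exists_feasibleP1_of_lt_optP2 (M : SwiptBC N KI KE) (hKI : 1 ≤ KI) (hKE : 1 ≤ KE)
    (hσ : 0 < M.σ) (hα : ∀ i, 0 < M.α i) (hE : ∀ j, 0 < M.E j)
    (hfeas : ∃ x : Point N KI, M.FeasibleP1 x) {c : ℝ} (hc : 0 < c) (hlt : (c : EReal) < M.optP2) :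
    ∃ x : Point N KI, M.FeasibleP1 x ∧ c ≤ M.wsr x.r := by
  have hs := isPowerSystem_constr M hKE hE hfeas
  have ha := antitone_sortedWeight M hα
  -- Only multipliers with positive definite `A` are used; each gives an auxiliary point of value
  -- above `c`, which is carried over to the MAC.
  have hweak : ∀ y : Option (Fin KE) → ℝ, (∀ j, 0 ≤ y j) → (linCov M.constrMatrix y).PosDef →
      ∃ p ∈ powerSimplex KI, c ≤ macWsr KI M.sortedChannel M.sortedWeight
        (linCov M.constrMatrix y) (fun k => linBudget M.constrBound y * p k) := by
    intro y hy hA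
    have h1 : (c : EReal) < M.gAux (y none) fun j => y (some j) :=
      hlt.trans_le (sInf_le ⟨_, _, hy none, fun j => hy (some j), rfl⟩)
    obtain ⟨_, ⟨x, ⟨hadm, hbudget⟩, rfl⟩, hcx⟩ := lt_sSup_iff.1 h1
    rw [← linCov_constrMatrix, ← linBudget_constrBound] at hbudget
    obtain ⟨p, hp, hle⟩ := exists_powerSimplex_wsr_le M hKI hσ hα hadm hA
      (linBudget_pos hs hy hA) hbudget
    exact ⟨p, hp, (EReal.coe_lt_coe_iff.1 hcx).le.trans hle⟩
  obtain ⟨S, SE, hS, hSE, hcon, hval⟩ := exists_bc_of_approx M.sortedChannel M.sortedWeight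
    hs.exists_one fun tol htol =>
      exists_bc_approx hKI M.sortedChannel ha M.sortedWeight_card hs hc hweak htol
  set τ := M.sortPerm with hτ
  set T : Fin KI → Matrix (Fin N) (Fin N) ℂ := fun u => S (τ.symm u) with hT
  have hTpos : ∀ u, (T u).PosSemidef := fun u => hS _
  have hsum : ∑ u, T u = ∑ k ∈ Finset.range KI, S k := by
    rw [Finset.sum_range, ← Equiv.sum_comp τ.symm fun i : Fin KI => S i]
  have hrate : ∀ i : Fin KI, bcRate KI M.sortedChannel S i = Real.log 2 * M.dpcRate T τ i :=
    bcRate_eq_dpcRate M hσ T hTpos τ (fun i => finExtend_val _ i) (fun i => by simp [hT])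
  -- The encoding order is the sorted one, and every rate equals its dirty-paper bound.
  refine ⟨⟨T, fun u => M.dpcRate T τ (τ.symm u), SE⟩, ⟨⟨?_, hSE, hTpos⟩, ?_⟩, ?_⟩
  · exact Set.mem_iUnion.2 ⟨τ, fun u => dpcRate_nonneg M hσ hTpos τ _, fun i => by simp⟩
  · simp only [hsum]
    exact (trMul_constr_le_iff M _).1 hcon
  · refine hval.trans (le_of_eq ?_)
    rw [wsr, Finset.sum_range,
      ← Equiv.sum_comp τ fun u => M.α u * M.dpcRate T τ (τ.symm u)]
    refine Finset.sum_congr rfl fun i _ => ?_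
    have hlog2 : Real.log 2 ≠ 0 := (Real.log_pos one_lt_two).ne'
    rw [hrate, sortedWeight, finExtend_val, ← hτ]
    simp only [Equiv.symm_apply_apply]
    field_simp

lemma optP2_le_optP1 (M : SwiptBC N KI KE) (hKI : 1 ≤ KI) (hKE : 1 ≤ KE)
    (hσ : 0 < M.σ) (hα : ∀ i, 0 < M.α i) (hE : ∀ j, 0 < M.E j)
    (hfeas : ∃ x : Point N KI, M.FeasibleP1 x) : M.optP2 ≤ M.optP1 := by
  refine EReal.ge_of_forall_gt_iff_ge.1 fun c hlt => ?_
  by_cases hc : 0 < c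
  · obtain ⟨x, hx, hcx⟩ := exists_feasibleP1_of_lt_optP2 M hKI hKE hσ hα hE hfeas hc hlt
    exact (EReal.coe_le_coe_iff.2 hcx).trans (le_sSup ⟨x, hx, rfl⟩)
  -- A nonpositive `c` lies below the weighted sum-rate of any feasible point.
  · obtain ⟨x, hx⟩ := hfeas
    exact (EReal.coe_le_coe_iff.2 ((not_lt.1 hc).trans (wsr_nonneg M hα hx.1))).trans
      (le_sSup ⟨x, hx, rfl⟩)

end SwiptBC

end

theorem lemma3p4 {N KI KE : ℕ} (hN : 1 < N) (hKI : 1 ≤ KI) (hKE : 1 ≤ KE)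
    (M : SwiptBC N KI KE) (hσ : 0 < M.σ) (hα : ∀ i, 0 < M.α i) (hP : 0 < M.Psum)
    (hE : ∀ j, 0 < M.E j) (hfeas : ∃ x : SwiptBC.Point N KI, M.FeasibleP1 x) :
    M.optP1 = M.optP2 :=
  le_antisymm (SwiptBC.optP1_le_optP2 M) (SwiptBC.optP2_le_optP1 M hKI hKE hσ hα hE hfeas)
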